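/- Let $f=\frac1n\sum_{i=1}^n f_i$ on $\mathbb{R}^d$, where each $f_i$ is convex, differentiable with $L$-Lipschitz gradient and depends only on the coordinates in a set $T_i\subseteq[d]$, where every coordinate lies in some $T_i$, and where for some $x^\star$ and $\mu>0$ the quadratic growth condition $f(x)-f(x^\star)\ge\frac\mu2\|x-x^\star\|^2$ holds for all $x$ (this holds in particular if $f$ is $\mu$-strongly convex with minimizer $x^\star$). Put $\kappa=L/\mu$, $\Delta=\frac1n\max_{v}|\{i:v\in T_i\}|$, let $D$ be the diagonal matrix with entries $D_{vv}=n/|\{i:v\in T_i\}|$, and let $D_i$ be $D$ with the diagonal entries outside $T_i$ set to $0$. Consider the asynchronous sparse accelerated SVRG method with $R$ rounds of $S$ epochs of $m$ inner iterations, started at $x_0$. Round $r$ starts with $\tilde x_0=z^0_0=x_r$. In epoch $s$, with $z_k=z^s_k$, $i_k$ uniform in $[n]$, and inner iterations ordered by the completion of their reads of the shared memory, $$\hat y_k=\vartheta\hat z_k+(1-\vartheta)\tilde x_s-\varphi D\nabla f(\tilde x_s),\quad G_k=\nabla f_{i_k}(\hat y_k)-\nabla f_{i_k}(\tilde x_s)+D_{i_k}\nabla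 f(\tilde x_s),\quad z_{k+1}=z_k-\eta G_k ,$$ where the inconsistent read is $[\hat z_k]_v=[z_0]_v-\eta\sum_j[G_j]_v$, the sum being over those $j<k$ for which coordinate $v$ was written before read $k$. Then $z^{s+1}_0=z^s_m$, $\tilde x_{s+1}=\hat y_t$ with $t$ uniform in $\{0,\dots,m-1\}$ and independent of $\hat y_0,\dots,\hat y_{m-1}$, and $x_{r+1}=\frac1S\sum_{s=0}^{S-1}\tilde x_{s+1}$. Assume that the overlaps are bounded by $\tau$ (read $k$ sees all writes of every iteration $j<k-\tau$) and that $i_k$ is independent of the snapshot $\tilde x_s$, the reads $\hat z_0,\dots,\hat z_k$ and the earlier samples $i_0,\dots,i_{k-1}$ of the epoch, jointly. Let $\omega>1$ and $c_1,c_2,c>0$ be constants, let $c_1n\le m\le c_2n$, suppose $\tau\le\frac{c}{\sqrt\Delta}\max\{\frac n\kappa,1\}$, let $\tilde\tau$ be any real number with $\tau\le\tilde\tau\le\frac{c}{\sqrt\Delta}\max\{\frac n\kappa,1\}$, and set, with $\rho=1+2\sqrt\Delta\,\tilde\tau$, $$\vartheta=\frac{\sqrt m}{\sqrt{\kappa\rho}+\sqrt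 m},\quad \varphi=\frac{1-\vartheta}{L},\quad \eta=\frac{1-\vartheta}{L\vartheta\rho},\quad S=\Big\lceil 2\omega\sqrt{\tfrac{\kappa}{m}\rho}\,\Big\rceil .$$ Then there is a constant $C$ depending only on $\omega,c_1,c_2,c$ such that $S\le C\max\{1,\sqrt{\kappa/n}\}$, and for every $x_0$ and every $\epsilon>0$ there is a number of rounds $R\le C\,\ell$, where $\ell=\max\{1,\log\frac{f(x_0)-f(x^\star)}{\epsilon}\}$ (read as $1$ if $f(x_0)=f(x^\star)$), for which every such execution outputs $x_R$ with $\mathbb{E}f(x_R)-f(x^\star)\le\epsilon$, the number of incremental gradient computations being $$\#\mathrm{grad}=R\cdot S\cdot(n+2m)\le C\max\{n,\sqrt{\kappa n}\}\,\ell .$$ -/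

import Mathlib

open MeasureTheory ProbabilityTheory

noncomputable section

namespace AsyncSVRG

/-- `ℝ^d` with the Euclidean norm. -/
abbrev Vec (d : ℕ) := EuclideanSpace ℝ (Fin d)

/-! ### The sparse finite-sum problem -/

section Problem

variable {n d : ℕ}

/-- The objective `f = (1/n) ∑ i, f_i`. -/
def obj (f : Fin n → Vec d → ℝ) (x : Vec d) : ℝ := (1 / (n : ℝ)) * ∑ i, f i x

/-- The problem class: every `f_i` is convex and `L`-smooth and depends only on the coordinates in
`T i`; every coordinate lies in some `T i`; the average `f` has `μ`-quadratic growth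
around `xstar`, which is weaker than `μ`-strong convexity of `f` and makes `xstar` its unique
minimizer. -/
structure IsProblem (f : Fin n → Vec d → ℝ) (T : Fin n → Finset (Fin d)) (L μ : ℝ)
    (xstar : Vec d) : Prop where
  n_pos : 0 < n
  L_pos : 0 < L
  mu_pos : 0 < μ
  convex : ∀ i, ConvexOn ℝ Set.univ (f i)
  differentiable : ∀ i, Differentiable ℝ (f i)
  smooth : ∀ i x y, ‖gradient (f i) x - gradient (f i) y‖ ≤ L * ‖x - y‖
  support : ∀ i x y, (∀ v ∈ T i, x v = y v) → f i x = f i y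
  covered : ∀ v, ∃ i, v ∈ T i
  growth : ∀ x, μ / 2 * ‖x - xstar‖ ^ 2 ≤ obj f x - obj f xstar

/-- The sparsity measure `Δ = (1/n) max_v |{i : v ∈ T_i}|`. -/
def sparsity (T : Fin n → Finset (Fin d)) : ℝ :=
  (1 / (n : ℝ)) *
    ((Finset.univ.sup fun v : Fin d => (Finset.univ.filter fun i : Fin n => v ∈ T i).card : ℕ) : ℝ)

/-- The `v`-th diagonal entry of `D = ((1/n) ∑ i, P_i)⁻¹`, where `P_i` is the diagonal projection
onto the coordinates in `T i`. -/
def diagD (T : Fin n → Finset (Fin d)) (v : Fin d) : ℝ :=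
  ((1 / (n : ℝ)) * ∑ i, if v ∈ T i then (1 : ℝ) else 0)⁻¹

/-- The vector `D x`. -/
def applyD (T : Fin n → Finset (Fin d)) (x : Vec d) : Vec d :=
  WithLp.toLp 2 fun v => diagD T v * x v

/-- The vector `D_i x`, where `D_i = P_i D`. -/
def applyDi (T : Fin n → Finset (Fin d)) (i : Fin n) (x : Vec d) : Vec d :=
  WithLp.toLp 2 fun v => if v ∈ T i then diagD T v * x v else 0

/-- The sparse variance-reduced gradient estimator `∇f_i(y) - ∇f_i(x̃) + D_i ∇f(x̃)`. -/
def gradEst (f : Fin n → Vec d → ℝ) (T : Fin n → Finset (Fin d)) (i : Fin n)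
    (y xt : Vec d) : Vec d :=
  gradient (f i) y - gradient (f i) xt + applyDi T i (gradient (obj f) xt)

/-- The coupling step `ϑ z + (1 - ϑ) x̃ - φ D ∇f(x̃)`. -/
def couple (f : Fin n → Vec d → ℝ) (T : Fin n → Finset (Fin d)) (ϑ φ : ℝ)
    (z xt : Vec d) : Vec d :=
  ϑ • z + (1 - ϑ) • xt - φ • applyD T (gradient (obj f) xt)

end Problem

/-! ### Parameters and oracle count

In these definitions `ρ` stands for `1 + 2 √Δ τ̃`. -/

/-- `ϑ = √m / (√(κ ρ) + √m)`. -/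
def theta (κ ρ : ℝ) (m : ℕ) : ℝ := √(m : ℝ) / (√(κ * ρ) + √(m : ℝ))

/-- `φ = (1 - ϑ) / L`. -/
def phi (L ϑ : ℝ) : ℝ := (1 - ϑ) / L

/-- `η = (1 - ϑ) / (L ϑ ρ)`. -/
def eta (L ϑ ρ : ℝ) : ℝ := (1 - ϑ) / (L * ϑ * ρ)

/-- The number of epochs per round, `S = ⌈2 ω √(κ ρ / m)⌉`. -/
def epochs (ω κ ρ : ℝ) (m : ℕ) : ℕ := ⌈2 * ω * √(κ / (m : ℝ) * ρ)⌉₊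

/-- The number of incremental gradients `∇f_i(·)` computed in `R` rounds: each epoch computes a full
gradient (`n` of them), and each of its `m` inner iterations computes two. -/
def oracleCalls (n m S R : ℕ) : ℕ :=
  ∑ _r ∈ Finset.range R, ∑ _s ∈ Finset.range S, (n + ∑ _k ∈ Finset.range m, 2)

/-! ### The asynchronous algorithm -/

/-- The random quantities of an execution. Here `r` is the round (restart), `s` the epoch and `k` the
inner iteration; inner iterations are numbered in the order in which their reads of the shared
memory are completed. -/
structure Execution (Ω : Type*) (n d m : ℕ) where
  /-- the restart point `x_r` -/
  x : ℕ → Ω → Vec d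
  /-- the snapshot `x̃_s` of round `r` -/
  snap : ℕ → ℕ → Ω → Vec d
  /-- the virtual iterate `z_k` of epoch `s` of round `r` -/
  z : ℕ → ℕ → ℕ → Ω → Vec d
  /-- the inconsistent read `ẑ_k` -/
  zhat : ℕ → ℕ → ℕ → Ω → Vec d
  /-- the sample `i_k` -/
  sample : ℕ → ℕ → ℕ → Ω → Fin n
  /-- `written r s k j`: the coordinates that were written for iteration `j` before read `k` -/
  written : ℕ → ℕ → ℕ → ℕ → Ω → Finset (Fin d)
  /-- the index `t` of the iterate that becomes the next snapshot -/
  index : ℕ → ℕ → Ω → Fin m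

section Run

variable {Ω : Type*} {n d m : ℕ}

/-- `ŷ_k = ϑ ẑ_k + (1 - ϑ) x̃_s - φ D ∇f(x̃_s)`. -/
def Execution.yhat (A : Execution Ω n d m) (f : Fin n → Vec d → ℝ) (T : Fin n → Finset (Fin d))
    (ϑ φ : ℝ) (r s k : ℕ) (w : Ω) : Vec d :=
  couple f T ϑ φ (A.zhat r s k w) (A.snap r s w)

/-- The `k`-th update direction `∇f_{i_k}(ŷ_k) - ∇f_{i_k}(x̃_s) + D_{i_k} ∇f(x̃_s)`. -/
def Execution.grad (A : Execution Ω n d m) (f : Fin n → Vec d → ℝ) (T : Fin n → Finset (Fin d))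
    (ϑ φ : ℝ) (r s k : ℕ) (w : Ω) : Vec d :=
  gradEst f T (A.sample r s k w) (A.yhat f T ϑ φ r s k w) (A.snap r s w)

/-- `A` is an execution of the asynchronous sparse accelerated SVRG method started at `x0`, with `R`
rounds of `S` epochs of `m` inner iterations, in which the overlaps are bounded by `τ` and every
sample is independent of what has been read and sampled before it. -/
structure IsRun [MeasurableSpace Ω] (P : Measure Ω) (A : Execution Ω n d m)
    (f : Fin n → Vec d → ℝ) (T : Fin n → Finset (Fin d)) (ϑ φ η : ℝ) (S R τ : ℕ)
    (x0 : Vec d) : Prop where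
  /-- the initial guess -/
  init : ∀ w, A.x 0 w = x0
  /-- `x̃_0 = z = x_r` at the start of a round -/
  snap_zero : ∀ r < R, ∀ w, A.snap r 0 w = A.x r w
  z_zero : ∀ r < R, ∀ w, A.z r 0 0 w = A.x r w
  /-- `z_{k+1} = z_k - η G_k` -/
  z_step : ∀ r < R, ∀ s < S, ∀ k < m, ∀ w,
    A.z r s (k + 1) w = A.z r s k w - η • A.grad f T ϑ φ r s k w
  /-- the shared variable is kept between epochs -/
  z_epoch : ∀ r < R, ∀ s < S, ∀ w, A.z r (s + 1) 0 w = A.z r s m w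
  /-- `[ẑ_k]_v = [z_0]_v - η ∑ [G_j]_v` over the `j < k` for which coordinate `v` was written before
  read `k` -/
  read : ∀ r < R, ∀ s < S, ∀ k < m, ∀ w v,
    A.zhat r s k w v = A.z r s 0 w v -
      η * ∑ j ∈ Finset.range k,
        if v ∈ A.written r s k j w then A.grad f T ϑ φ r s j w v else 0
  /-- bounded overlaps: read `k` sees all the writes of each iteration `j < k - τ` -/
  overlap : ∀ r < R, ∀ s < S, ∀ k < m, ∀ j, j + τ < k → ∀ w,
    T (A.sample r s j w) ⊆ A.written r s k j w
  /-- `x̃_{s+1} = ŷ_t` -/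
  snap_succ : ∀ r < R, ∀ s < S, ∀ w,
    A.snap r (s + 1) w = A.yhat f T ϑ φ r s (A.index r s w) w
  /-- `x_{r+1} = (1/S) ∑_{s<S} x̃_{s+1}` -/
  restart : ∀ r < R, ∀ w,
    A.x (r + 1) w = (1 / (S : ℝ)) • ∑ s ∈ Finset.range S, A.snap r (s + 1) w
  measurable_zhat : ∀ r < R, ∀ s < S, ∀ k < m, Measurable (A.zhat r s k)
  measurable_sample : ∀ r < R, ∀ s < S, ∀ k < m, Measurable (A.sample r s k)
  measurable_index : ∀ r < R, ∀ s < S, Measurable (A.index r s)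
  /-- `i_k` is uniform in `[n]` -/
  sample_uniform : ∀ r < R, ∀ s < S, ∀ k < m, ∀ i,
    P.real {w | A.sample r s k w = i} = 1 / (n : ℝ)
  /-- `i_k` is independent of the snapshot, of the reads `ẑ_0, …, ẑ_k` and of the samples
  `i_0, …, i_{k-1}` -/
  sample_indep : ∀ r < R, ∀ s < S, ∀ k < m,
    IndepFun (A.sample r s k)
      (fun w => (A.snap r s w, (fun j : Fin (k + 1) => A.zhat r s j w),
        (fun j : Fin k => A.sample r s j w))) P
  /-- `t` is uniform in `{0, …, m-1}` -/
  index_uniform : ∀ r < R, ∀ s < S, ∀ t, P.real {w | A.index r s w = t} = 1 / (m : ℝ)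
  /-- `t` is independent of `ŷ_0, …, ŷ_{m-1}` -/
  index_indep : ∀ r < R, ∀ s < S,
    IndepFun (A.index r s) (fun w => fun k : Fin m => A.yhat f T ϑ φ r s k w) P

end Run

end AsyncSVRG

end

namespace AsyncSVRG

/-! ### Smooth convex functions -/

section Smooth

variable {E : Type*} [NormedAddCommGroup E] [InnerProductSpace ℝ E] [CompleteSpace E] {g : E → ℝ}

/-! The proof is an energy argument in which every error term is a multiple of `E‖G_k‖²`. Since the
`D_i` average to the identity, `G_k` is an unbiased estimate of `∇f(ŷ_k)` given the past. The shift
`-φ D ∇f(x̃)` in the coupling step matches the cross term in the second moment of `G_k`, so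
`couple_progress` has the negative term `-(1-ϑ)/(2Lϑ) E‖G_k‖² = -(ηρ/2) E‖G_k‖²` to spend.

This pays for two things. Replacing `⟨G_k, z_k - x⋆⟩` by a telescoping difference of squared
distances costs `(η/2) E‖G_k‖²`. Replacing `ẑ_k` by `z_k` costs `η⟨G_k, unseen part of G_j⟩` for at
most `τ` indices `j`. Only the coordinates in `T_{i_k}` matter there, and `i_k` is independent of
`G_j`, so `E‖G_j restricted to T_{i_k}‖² ≤ Δ E‖G_j‖²`. Over an epoch the total cost is at most
`(η/2)(1 + 2√Δ τ) ∑ E‖G_k‖²`, which `ρ` covers (`epoch`).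

Summing over the epochs of a round, quadratic growth bounds the initial squared distance by the
initial gap, and Jensen's inequality handles the average (`round`). The resulting factor is
`2√(κρ/m)/S ≤ 1/ω`, so `O(ℓ)` rounds suffice. The restriction on `τ̃` gives `κρ/m = O(max{1, κ/n})`,
which bounds `S`. -/

theorem hasDerivAt_line (hd : Differentiable ℝ g) (x u : E) (t : ℝ) :
    HasDerivAt (fun t : ℝ => g (x + t • u)) (inner ℝ (gradient g (x + t • u)) u) t := by
  have h1 := (hd (x + t • u)).hasGradientAt.hasFDerivAt
  have h2 : HasDerivAt (fun t : ℝ => x + t • u) u t := by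
    simpa using ((hasDerivAt_id t).smul_const u).const_add x
  have := h1.comp_hasDerivAt t h2
  rw [InnerProductSpace.toDual_apply_apply] at this
  exact this

theorem inner_gradient_le_sub (hc : ConvexOn ℝ Set.univ g) (hd : Differentiable ℝ g) (x y : E) :
    inner ℝ (gradient g x) (y - x) ≤ g y - g x := by
  have hl : ConvexOn ℝ Set.univ (fun t : ℝ => g (x + t • (y - x))) := by
    have := hc.comp_affineMap (AffineMap.lineMap x y : ℝ →ᵃ[ℝ] E)
    simp only [Set.preimage_univ] at this
    refine this.congr fun t _ => ?_
    simp [AffineMap.lineMap_apply, add_comm]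
  have := hl.le_slope_of_hasDerivAt (Set.mem_univ 0) (Set.mem_univ 1) one_pos
    (hasDerivAt_line hd x (y - x) 0)
  simpa [slope_def_field] using this

/-- Along the segment, `g` minus the claimed upper bound has nonpositive derivative, by
Cauchy-Schwarz and the Lipschitz condition. -/
theorem le_quadratic_of_lipschitz_gradient {L : ℝ} (hd : Differentiable ℝ g)
    (hL : ∀ x y, ‖gradient g x - gradient g y‖ ≤ L * ‖x - y‖) (x y : E) :
    g y ≤ g x + inner ℝ (gradient g x) (y - x) + L / 2 * ‖y - x‖ ^ 2 := by
  set u := y - x with hu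
  have hderiv : ∀ t : ℝ, HasDerivAt
      (fun t : ℝ => g (x + t • u) - (t * inner ℝ (gradient g x) u + L / 2 * ‖u‖ ^ 2 * t ^ 2))
      (inner ℝ (gradient g (x + t • u)) u - (inner ℝ (gradient g x) u + L * t * ‖u‖ ^ 2)) t := by
    intro t
    refine (hasDerivAt_line hd x u t).sub (HasDerivAt.add ?_ ?_)
    · simpa using (hasDerivAt_id t).mul_const (inner ℝ (gradient g x) u)
    · refine ((hasDerivAt_pow 2 t).const_mul (L / 2 * ‖u‖ ^ 2)).congr_deriv ?_
      push_cast; ring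
  have hanti : AntitoneOn
      (fun t : ℝ => g (x + t • u) - (t * inner ℝ (gradient g x) u + L / 2 * ‖u‖ ^ 2 * t ^ 2))
      (Set.Icc 0 1) := by
    refine antitoneOn_of_deriv_nonpos (convex_Icc 0 1)
      (fun t _ => (hderiv t).continuousAt.continuousWithinAt)
      (fun t _ => (hderiv t).differentiableAt.differentiableWithinAt) fun t ht => ?_
    rw [interior_Icc] at ht
    rw [(hderiv t).deriv]
    have h1 : inner ℝ (gradient g (x + t • u) - gradient g x) u ≤ L * t * ‖u‖ ^ 2 := by
      refine (real_inner_le_norm _ _).trans ?_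
      have := hL (x + t • u) x
      rw [add_sub_cancel_left, norm_smul, Real.norm_of_nonneg ht.1.le] at this
      calc _ ≤ L * (t * ‖u‖) * ‖u‖ := by gcongr
        _ = _ := by ring
    rw [inner_sub_left] at h1
    linarith
  have := hanti (Set.left_mem_Icc.2 zero_le_one) (Set.right_mem_Icc.2 zero_le_one) zero_le_one
  simp only [one_smul, zero_smul, add_zero] at this
  rw [show x + u = y by rw [hu]; abel] at this
  linarith

/-- Compare two bounds at the point `y - (1/L) w`, with `w` the gradient difference: the tangent at
`x` from below and the quadratic model at `y` from above. -/
theorem add_sq_norm_gradient_sub_le {L : ℝ} (hLpos : 0 < L) (hc : ConvexOn ℝ Set.univ g)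
    (hd : Differentiable ℝ g) (hL : ∀ x y, ‖gradient g x - gradient g y‖ ≤ L * ‖x - y‖) (x y : E) :
    g x + inner ℝ (gradient g x) (y - x) + 1 / (2 * L) * ‖gradient g y - gradient g x‖ ^ 2 ≤ g y := by
  set w := gradient g y - gradient g x with hw
  have h1 := inner_gradient_le_sub hc hd x (y - (1 / L) • w)
  have h2 := le_quadratic_of_lipschitz_gradient hd hL y (y - (1 / L) • w)
  have h3 : y - (1 / L) • w - x = (y - x) - (1 / L) • w := by abel
  have h4 : y - (1 / L) • w - y = -((1 / L) • w) := by abel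
  rw [h3, inner_sub_right, inner_smul_right] at h1
  rw [h4, inner_neg_right, inner_smul_right, norm_neg, norm_smul,
    Real.norm_of_nonneg (by positivity : (0 : ℝ) ≤ 1 / L)] at h2
  have h5 : inner ℝ (gradient g y) w - inner ℝ (gradient g x) w = ‖w‖ ^ 2 := by
    rw [← inner_sub_left, ← hw, real_inner_self_eq_norm_sq]
  have h6 : L / 2 * (1 / L * ‖w‖) ^ 2 = 1 / (2 * L) * ‖w‖ ^ 2 := by field_simp
  have h7 : 1 / L * inner ℝ (gradient g y) w - 1 / L * inner ℝ (gradient g x) w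
      = 2 * (1 / (2 * L) * ‖w‖ ^ 2) := by
    rw [← mul_sub, h5]; field_simp
  rw [h6] at h2
  linarith

end Smooth

/-! ### Coordinate masks and the sparse estimator -/

section Estimator

variable {n d : ℕ}

/-- The vector `x` with the coordinates outside `s` set to `0`. -/
noncomputable def mask (s : Finset (Fin d)) (x : Vec d) : Vec d :=
  WithLp.toLp 2 fun v => if v ∈ s then x v else 0

@[simp] theorem mask_apply (s : Finset (Fin d)) (x : Vec d) (v : Fin d) :
    mask s x v = if v ∈ s then x v else 0 := rfl

theorem applyDi_eq_mask (T : Fin n → Finset (Fin d)) (i : Fin n) (x : Vec d) :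
    applyDi T i x = mask (T i) (applyD T x) := rfl

theorem inner_eq_sum (x y : Vec d) : inner ℝ x y = ∑ v, x v * y v := by
  simp [PiLp.inner_apply, mul_comm]

theorem inner_mask_of_support {s : Finset (Fin d)} {x : Vec d} (hx : ∀ v ∉ s, x v = 0)
    (y : Vec d) : inner ℝ x (mask s y) = inner ℝ x y := by
  rw [inner_eq_sum, inner_eq_sum]
  refine Finset.sum_congr rfl fun v _ => ?_
  by_cases hv : v ∈ s <;> simp [hv, hx]

theorem norm_le_norm_of_abs_le {x y : Vec d} (h : ∀ v, |x v| ≤ |y v|) : ‖x‖ ≤ ‖y‖ := by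
  rw [EuclideanSpace.norm_eq, EuclideanSpace.norm_eq]
  refine Real.sqrt_le_sqrt (Finset.sum_le_sum fun v _ => ?_)
  rw [Real.norm_eq_abs, Real.norm_eq_abs]
  exact pow_le_pow_left₀ (abs_nonneg _) (h v) 2

theorem norm_mask_le (s : Finset (Fin d)) (x : Vec d) : ‖mask s x‖ ≤ ‖x‖ :=
  norm_le_norm_of_abs_le fun v => by by_cases hv : v ∈ s <;> simp [hv]

/-- Applied with `x = G_k`, `s = T_{i_k}`, `z = G_j` and `y` the part of `G_j` missed by read `k`.
The bound no longer involves the write pattern, which may depend on the samples. -/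
theorem inner_le_norm_mul_norm_mask {s : Finset (Fin d)} {x y z : Vec d} (hx : ∀ v ∉ s, x v = 0)
    (hyz : ∀ v, |y v| ≤ |z v|) : inner ℝ x y ≤ ‖x‖ * ‖mask s z‖ := by
  rw [← inner_mask_of_support hx y]
  refine (real_inner_le_norm _ _).trans (mul_le_mul_of_nonneg_left ?_ (norm_nonneg _))
  refine norm_le_norm_of_abs_le fun v => ?_
  by_cases hv : v ∈ s <;> simp [hv, hyz]

variable {f : Fin n → Vec d → ℝ} {T : Fin n → Finset (Fin d)} {L μ : ℝ} {xstar : Vec d}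

namespace IsProblem

theorem natCast_pos (h : IsProblem f T L μ xstar) : (0 : ℝ) < n := Nat.cast_pos.2 h.n_pos

theorem gradient_apply_eq_zero (h : IsProblem f T L μ xstar) (i : Fin n) (x : Vec d) {v : Fin d}
    (hv : v ∉ T i) : gradient (f i) x v = 0 := by
  have h1 := hasDerivAt_line (h.differentiable i) x (EuclideanSpace.single v 1) 0
  have h2 : (fun t : ℝ => f i (x + t • EuclideanSpace.single v 1)) = fun _ => f i x := by
    funext t
    refine h.support i _ _ fun u hu => ?_
    have : u ≠ v := fun e => hv (e ▸ hu)
    simp [this]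
  rw [h2] at h1
  have := h1.unique (hasDerivAt_const _ _)
  rw [zero_smul, add_zero, EuclideanSpace.inner_single_right] at this
  simpa using this

theorem differentiable_obj (h : IsProblem f T L μ xstar) : Differentiable ℝ (obj f) :=
  (Differentiable.fun_sum fun i _ => h.differentiable i).const_mul _

theorem convexOn_obj (h : IsProblem f T L μ xstar) : ConvexOn ℝ Set.univ (obj f) := by
  refine ⟨convex_univ, fun x _ y _ a b ha hb hab => ?_⟩
  simp only [obj, smul_eq_mul]
  rw [mul_left_comm a, mul_left_comm b, ← mul_add, Finset.mul_sum (a := a), Finset.mul_sum (a := b),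
    ← Finset.sum_add_distrib]
  refine mul_le_mul_of_nonneg_left (Finset.sum_le_sum fun i _ => ?_) (by positivity)
  simpa using (h.convex i).2 (Set.mem_univ x) (Set.mem_univ y) ha hb hab

theorem gradient_obj (h : IsProblem f T L μ xstar) (x : Vec d) :
    gradient (obj f) x = (1 / (n : ℝ)) • ∑ i, gradient (f i) x := by
  refine HasGradientAt.gradient (hasGradientAt_iff_hasFDerivAt.2 ?_)
  rw [map_smul, map_sum]
  exact (HasFDerivAt.fun_sum fun i _ => (h.differentiable i x).hasGradientAt.hasFDerivAt).const_mul _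

theorem avg_inner_gradient (h : IsProblem f T L μ xstar) (x u : Vec d) :
    (1 / (n : ℝ)) * ∑ i, inner ℝ (gradient (f i) x) u = inner ℝ (gradient (obj f) x) u := by
  rw [h.gradient_obj, real_inner_smul_left, sum_inner]

theorem continuous_gradient (h : IsProblem f T L μ xstar) (i : Fin n) :
    Continuous (gradient (f i)) := by
  have : LipschitzWith L.toNNReal (gradient (f i)) := LipschitzWith.of_dist_le_mul fun x y => by
    rw [dist_eq_norm, dist_eq_norm, Real.coe_toNNReal _ h.L_pos.le]
    exact h.smooth i x y
  exact this.continuous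

theorem continuous_gradient_obj (h : IsProblem f T L μ xstar) : Continuous (gradient (obj f)) := by
  rw [show gradient (obj f) = fun x => (1 / (n : ℝ)) • ∑ i, gradient (f i) x from
    funext h.gradient_obj]
  exact (continuous_finsetSum _ fun i _ => h.continuous_gradient i).const_smul (1 / (n : ℝ))

theorem sum_indicator_pos (h : IsProblem f T L μ xstar) (v : Fin d) :
    0 < ∑ i, if v ∈ T i then (1 : ℝ) else 0 := by
  obtain ⟨i, hi⟩ := h.covered v
  refine Finset.sum_pos' (fun j _ => by split_ifs <;> simp) ⟨i, Finset.mem_univ i, by simp [hi]⟩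

theorem avg_applyDi (h : IsProblem f T L μ xstar) (x : Vec d) :
    (1 / (n : ℝ)) • ∑ i, applyDi T i x = x := by
  ext v
  have hs := h.sum_indicator_pos v
  have hn := h.natCast_pos
  have : ∀ i, applyDi T i x v = diagD T v * x v * if v ∈ T i then (1 : ℝ) else 0 := fun i => by
    simp [applyDi]
  simp only [PiLp.smul_apply, WithLp.ofLp_sum, Finset.sum_apply, this, ← Finset.mul_sum,
    smul_eq_mul, diagD]
  field_simp

theorem avg_inner_applyDi (h : IsProblem f T L μ xstar) (x u : Vec d) :
    (1 / (n : ℝ)) * ∑ i, inner ℝ (applyDi T i x) u = inner ℝ x u := by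
  rw [← sum_inner, ← real_inner_smul_left, h.avg_applyDi]

theorem inner_applyD_nonneg (T : Fin n → Finset (Fin d)) (x : Vec d) :
    0 ≤ inner ℝ x (applyD T x) := by
  rw [inner_eq_sum]
  refine Finset.sum_nonneg fun v _ => ?_
  have : 0 ≤ diagD T v := inv_nonneg.2 (mul_nonneg (by positivity)
    (Finset.sum_nonneg fun i _ => by split_ifs <;> simp))
  simp only [applyD]
  nlinarith [mul_nonneg this (mul_self_nonneg (x v))]

theorem gradEst_apply_eq_zero (h : IsProblem f T L μ xstar) (i : Fin n) (y xt : Vec d) {v : Fin d}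
    (hv : v ∉ T i) : gradEst f T i y xt v = 0 := by
  simp [gradEst, applyDi, hv, h.gradient_apply_eq_zero i _ hv]

theorem avg_inner_gradEst (h : IsProblem f T L μ xstar) (y xt u : Vec d) :
    (1 / (n : ℝ)) * ∑ i, inner ℝ (gradEst f T i y xt) u = inner ℝ (gradient (obj f) y) u := by
  simp only [gradEst, inner_add_left, inner_sub_left, Finset.sum_add_distrib,
    Finset.sum_sub_distrib, mul_add, mul_sub, h.avg_inner_gradient, h.avg_inner_applyDi]
  ring

/-- Gradients of `f_i` vanish off `T i`, so pairing them with `D_i u` is pairing them with `D u`;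
likewise `‖D_i u‖² = ⟨D_i u, D u⟩`, which averages to `⟨u, D u⟩`. -/
theorem avg_sq_norm_gradEst (h : IsProblem f T L μ xstar) (y xt : Vec d) :
    (1 / (n : ℝ)) * ∑ i, ‖gradEst f T i y xt‖ ^ 2 =
      (1 / (n : ℝ)) * ∑ i, ‖gradient (f i) y - gradient (f i) xt‖ ^ 2 +
        2 * inner ℝ (gradient (obj f) y) (applyD T (gradient (obj f) xt)) -
        inner ℝ (gradient (obj f) xt) (applyD T (gradient (obj f) xt)) := by
  set u := gradient (obj f) xt
  have key : ∀ i, ‖gradEst f T i y xt‖ ^ 2 = ‖gradient (f i) y - gradient (f i) xt‖ ^ 2 +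
      2 * (inner ℝ (gradient (f i) y) (applyD T u) - inner ℝ (gradient (f i) xt) (applyD T u)) +
      inner ℝ (applyDi T i u) (applyD T u) := by
    intro i
    rw [gradEst, norm_add_sq_real, applyDi_eq_mask, inner_mask_of_support, inner_sub_left,
      ← real_inner_self_eq_norm_sq (mask _ _), inner_mask_of_support]
    · exact fun v hv => by simp [hv]
    · exact fun v hv => by simp [h.gradient_apply_eq_zero i _ hv]
  simp only [key, Finset.sum_add_distrib, Finset.sum_sub_distrib, ← Finset.mul_sum, mul_add,
    h.avg_inner_applyDi]
  rw [mul_left_comm, mul_sub, h.avg_inner_gradient, h.avg_inner_gradient]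
  ring

/-- The deterministic part of the progress made by one inner iteration. -/
theorem couple_progress (h : IsProblem f T L μ xstar) {ϑ : ℝ} (h0 : 0 < ϑ) (h1 : ϑ < 1)
    (z xt : Vec d) {y : Vec d} (hy : y = couple f T ϑ (phi L ϑ) z xt) :
    1 / ϑ * (obj f y - obj f xstar) ≤ (1 - ϑ) / ϑ * (obj f xt - obj f xstar) -
      (1 - ϑ) / (2 * L * ϑ) * ((1 / (n : ℝ)) * ∑ i, ‖gradEst f T i y xt‖ ^ 2) +
      inner ℝ (gradient (obj f) y) (z - xstar) := by
  set u := applyD T (gradient (obj f) xt) with hu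
  have hL := h.L_pos
  have e1 := inner_gradient_le_sub h.convexOn_obj h.differentiable_obj y xstar
  have e2 : obj f y + inner ℝ (gradient (obj f) y) (xt - y) + 1 / (2 * L) * ((1 / (n : ℝ)) *
      ∑ i, ‖gradient (f i) y - gradient (f i) xt‖ ^ 2) ≤ obj f xt := by
    rw [← h.avg_inner_gradient, obj, obj, mul_left_comm, ← mul_add, ← mul_add, Finset.mul_sum,
      ← Finset.sum_add_distrib, ← Finset.sum_add_distrib]
    refine mul_le_mul_of_nonneg_left (Finset.sum_le_sum fun i _ => ?_) (by positivity)
    rw [norm_sub_rev]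
    exact add_sq_norm_gradient_sub_le hL (h.convex i) (h.differentiable i) (h.smooth i) y xt
  have e3 := h.avg_sq_norm_gradEst y xt
  have e4 := inner_applyD_nonneg T (gradient (obj f) xt)
  rw [← hu] at e3 e4
  -- The coupling equation solved for `xstar - y`; it is checked after multiplication by `ϑ`.
  have e5 : xstar - y = -((z - xstar) + ((1 - ϑ) / ϑ) • (xt - y) - (phi L ϑ / ϑ) • u) := by
    have e : ϑ • (xstar - y) =
        ϑ • -((z - xstar) + ((1 - ϑ) / ϑ) • (xt - y) - (phi L ϑ / ϑ) • u) := by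
      simp only [smul_neg, smul_sub, smul_add, smul_smul, mul_div_cancel₀ _ h0.ne']
      rw [← smul_sub (1 - ϑ)]
      have : y = ϑ • z + (1 - ϑ) • xt - phi L ϑ • u := hy
      have h2 : ϑ • y + (1 - ϑ) • y = y := by rw [← add_smul]; simp
      rw [smul_sub (1 - ϑ)]
      have h3 : (1 - ϑ) • y = (ϑ • z + (1 - ϑ) • xt - phi L ϑ • u) - ϑ • y := by
        rw [← this, eq_sub_iff_add_eq, add_comm, h2]
      rw [h3]; abel
    exact smul_right_injective _ h0.ne' e
  rw [e5, inner_neg_right, inner_sub_right, inner_add_right, inner_smul_right,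
    inner_smul_right] at e1
  rw [e3]
  set A := inner ℝ (gradient (obj f) y) (z - xstar)
  set B := inner ℝ (gradient (obj f) y) (xt - y)
  set Q := inner ℝ (gradient (obj f) y) u
  set V := (1 / (n : ℝ)) * ∑ i, ‖gradient (f i) y - gradient (f i) xt‖ ^ 2
  set W := inner ℝ (gradient (obj f) xt) u
  have e6 : (1 - ϑ) / ϑ * (obj f y + B + 1 / (2 * L) * V) ≤ (1 - ϑ) / ϑ * obj f xt :=
    mul_le_mul_of_nonneg_left e2 (div_nonneg (by linarith) h0.le)
  have e7 : 0 ≤ (1 - ϑ) / (2 * L * ϑ) * W := mul_nonneg (div_nonneg (by linarith) (by positivity)) e4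
  -- The value of `φ` makes the coefficient of `Q` agree with the one in `e1`, so `Q` cancels; `W`
  -- has a favourable sign.
  have e8 : (1 - ϑ) / (2 * L * ϑ) * (V + 2 * Q - W) = (1 - ϑ) / ϑ * (1 / (2 * L) * V) +
      phi L ϑ / ϑ * Q - (1 - ϑ) / (2 * L * ϑ) * W := by
    rw [phi]; field_simp
  have e9 : 1 / ϑ = 1 + (1 - ϑ) / ϑ := by field_simp; ring
  rw [e8, e9]
  linarith

/-- After exchanging the sums, each `x v ^ 2` is counted once per `i` with `v ∈ T i`, hence at most
`n Δ` times. -/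
theorem avg_sq_norm_mask_le (T : Fin n → Finset (Fin d)) (x : Vec d) :
    (1 / (n : ℝ)) * ∑ i, ‖mask (T i) x‖ ^ 2 ≤ sparsity T * ‖x‖ ^ 2 := by
  have h1 : ∀ i, ‖mask (T i) x‖ ^ 2 = ∑ v, if v ∈ T i then x v ^ 2 else 0 := fun i => by
    rw [EuclideanSpace.real_norm_sq_eq]
    exact Finset.sum_congr rfl fun v _ => by by_cases hv : v ∈ T i <;> simp [hv]
  simp only [h1, sparsity, mul_assoc]
  rw [Finset.sum_comm, EuclideanSpace.real_norm_sq_eq, Finset.mul_sum (f := fun v => x v ^ 2)]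
  refine mul_le_mul_of_nonneg_left (Finset.sum_le_sum fun v _ => ?_) (by positivity)
  rw [← Finset.sum_filter, Finset.sum_const, nsmul_eq_mul]
  refine mul_le_mul_of_nonneg_right (Nat.cast_le.2 ?_) (sq_nonneg _)
  exact Finset.le_sup (f := fun v : Fin d => (Finset.univ.filter fun i : Fin n => v ∈ T i).card)
    (Finset.mem_univ v)

theorem sparsity_pos (h : IsProblem f T L μ xstar) (v : Fin d) : 0 < sparsity T := by
  refine mul_pos (one_div_pos.2 h.natCast_pos) (Nat.cast_pos.2 ?_)
  obtain ⟨i, hi⟩ := h.covered v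
  refine lt_of_lt_of_le (Finset.card_pos.2 ⟨i, by simp [hi]⟩) (Finset.le_sup
    (f := fun v : Fin d => (Finset.univ.filter fun i : Fin n => v ∈ T i).card) (Finset.mem_univ v))

end IsProblem

end Estimator

end AsyncSVRG

namespace AsyncSVRG

/-! ### Bounded measurable functions -/

section BoundedMeasurable

variable {Ω E F : Type*} [NormedAddCommGroup E] [MeasurableSpace E]
  [NormedAddCommGroup F] [MeasurableSpace F]

/-- `g` is measurable with respect to `mΩ` and bounded. -/
def BoundedMeasurable (mΩ : MeasurableSpace Ω) (g : Ω → E) : Prop :=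
  Measurable[mΩ] g ∧ ∃ C, ∀ w, ‖g w‖ ≤ C

namespace BoundedMeasurable

variable {mΩ mΩ' : MeasurableSpace Ω} {g h : Ω → E}

theorem of_measurable (hg : BoundedMeasurable mΩ g) (hm : Measurable[mΩ'] g) :
    BoundedMeasurable mΩ' g := ⟨hm, hg.2⟩

theorem to_top (hg : BoundedMeasurable mΩ g) : BoundedMeasurable ⊤ g :=
  hg.of_measurable fun _ _ => trivial

theorem mono (hg : BoundedMeasurable mΩ g) (hm : mΩ ≤ mΩ') : BoundedMeasurable mΩ' g :=
  ⟨hg.1.mono hm le_rfl, hg.2⟩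

theorem const (c : E) : BoundedMeasurable mΩ fun _ : Ω => c := ⟨measurable_const, ‖c‖, fun _ => le_rfl⟩

theorem prodMk {k : Ω → F} (hg : BoundedMeasurable mΩ g) (hk : BoundedMeasurable mΩ k) :
    BoundedMeasurable (E := E × F) mΩ fun w => (g w, k w) := by
  obtain ⟨⟨C, hC⟩, ⟨K, hK⟩⟩ := And.intro hg.2 hk.2
  exact ⟨hg.1.prodMk hk.1, max C K, fun w => max_le_max (hC w) (hK w)⟩

theorem select {ι : Type*} [Finite ι] [MeasurableSpace ι] [MeasurableSingletonClass ι]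
    {X : Ω → ι} (hX : Measurable[mΩ] X) {Y : ι → Ω → E} (hY : ∀ i, BoundedMeasurable mΩ (Y i)) :
    BoundedMeasurable mΩ fun w => Y (X w) w := by
  have := Fintype.ofFinite ι
  choose C hC using fun i => (hY i).2
  refine ⟨?_, ∑ i, |C i|, fun w => (hC (X w) w).trans ((le_abs_self _).trans
    (Finset.single_le_sum (fun i _ => abs_nonneg (C i)) (Finset.mem_univ _)))⟩
  have h1 : Measurable fun p : ι × Ω => Y p.1 p.2 :=
    measurable_from_prod_countable_right fun i => (hY i).1
  exact h1.comp (hX.prodMk measurable_id)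

/-- Closed balls are compact, so continuous maps preserve boundedness. Every step of the algorithm
is such a map or a finite selection, and this settles all integrability questions. -/
theorem comp [BorelSpace E] [ProperSpace E] [BorelSpace F] (hg : BoundedMeasurable mΩ g) {q : E → F} (hq : Continuous q) :
    BoundedMeasurable mΩ fun w => q (g w) := by
  refine ⟨hq.measurable.comp hg.1, ?_⟩
  obtain ⟨C, hC⟩ := hg.2
  obtain ⟨K, hK⟩ := ((isCompact_closedBall (0 : E) C).image hq).isBounded.exists_norm_le
  exact ⟨K, fun w => hK _ ⟨g w, by simpa using hC w, rfl⟩⟩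

theorem comp₂ {E₁ E₂ : Type*} [NormedAddCommGroup E₁] [MeasurableSpace E₁] [BorelSpace E₁]
    [NormedAddCommGroup E₂] [MeasurableSpace E₂] [BorelSpace E₂] [ProperSpace E₁] [ProperSpace E₂]
    [SecondCountableTopology E₁] [BorelSpace F] {g : Ω → E₁} {k : Ω → E₂} (hg : BoundedMeasurable mΩ g)
    (hk : BoundedMeasurable mΩ k) {q : E₁ → E₂ → F} (hq : Continuous fun p : E₁ × E₂ => q p.1 p.2) :
    BoundedMeasurable mΩ fun w => q (g w) (k w) :=
  (hg.prodMk hk).comp hq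

theorem integrable [BorelSpace E] [SecondCountableTopology E] {P : @Measure Ω mΩ}
    [IsFiniteMeasure P] (hg : BoundedMeasurable mΩ g) : Integrable g P := by
  obtain ⟨C, hC⟩ := hg.2
  exact Integrable.of_bound hg.1.aestronglyMeasurable C (Filter.Eventually.of_forall hC)

theorem const_smul [BorelSpace E] [ProperSpace E] [NormedSpace ℝ E] (c : ℝ)
    (hg : BoundedMeasurable mΩ g) : BoundedMeasurable mΩ fun w => c • g w := hg.comp (by fun_prop)

variable [BorelSpace E] [ProperSpace E] [SecondCountableTopology E]

theorem add (hg : BoundedMeasurable mΩ g) (hh : BoundedMeasurable mΩ h) :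
    BoundedMeasurable mΩ fun w => g w + h w := hg.comp₂ hh (by fun_prop)

theorem sub (hg : BoundedMeasurable mΩ g) (hh : BoundedMeasurable mΩ h) :
    BoundedMeasurable mΩ fun w => g w - h w := hg.comp₂ hh (by fun_prop)

theorem sum {ι : Type*} (s : Finset ι) {Y : ι → Ω → E}
    (hY : ∀ i ∈ s, BoundedMeasurable mΩ (Y i)) : BoundedMeasurable mΩ fun w => ∑ i ∈ s, Y i w := by
  classical
  induction s using Finset.induction_on with
  | empty => simpa using const (0 : E)
  | insert i s hi ih =>
    simp only [Finset.sum_insert hi]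
    exact (hY i (Finset.mem_insert_self i s)).add
      (ih fun j hj => hY j (Finset.mem_insert_of_mem hj))

end BoundedMeasurable

theorem boundedMeasurable_inner {d : ℕ} {mΩ : MeasurableSpace Ω} {g h : Ω → Vec d}
    (hg : BoundedMeasurable mΩ g) (hh : BoundedMeasurable mΩ h) :
    BoundedMeasurable mΩ fun w => (inner ℝ (g w) (h w) : ℝ) := hg.comp₂ hh continuous_inner

theorem boundedMeasurable_sq_norm {d : ℕ} {mΩ : MeasurableSpace Ω} {g : Ω → Vec d}
    (hg : BoundedMeasurable mΩ g) : BoundedMeasurable mΩ fun w => ‖g w‖ ^ 2 :=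
  hg.comp (q := fun x => ‖x‖ ^ 2) (by fun_prop)

/-- If `X` is uniform and independent of `W`, and every `Y i` is a function of `W`, then
`E Y_X = (1/n) ∑ i, E Y_i`. -/
theorem integral_select {n : ℕ} {β : Type*} {mβ : MeasurableSpace β} [mΩ : MeasurableSpace Ω]
    {P : Measure Ω} [IsFiniteMeasure P] {X : Ω → Fin n} {W : Ω → β} (hX : Measurable X)
    (hW : Measurable W) (hind : IndepFun X W P) {p : ℝ} (hu : ∀ i, P.real {w | X w = i} = p)
    {Y : Fin n → Ω → ℝ} (hY : ∀ i, BoundedMeasurable (MeasurableSpace.comap W mβ) (Y i)) :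
    ∫ w, Y (X w) w ∂P = ∫ w, p * ∑ i, Y i w ∂P := by
  have hY' := fun i => (hY i).mono hW.comap_le
  have hI : ∀ i, Measurable fun j : Fin n => if j = i then (1 : ℝ) else 0 :=
    fun i => measurable_of_finite _
  have hB : ∀ i, BoundedMeasurable mΩ fun w => if X w = i then (1 : ℝ) else 0 := fun i =>
    ⟨(hI i).comp hX, 1, fun w => by by_cases hi : X w = i <;> simp [hi]⟩
  -- Each indicator is independent of `Y i`, so the expectation factors term by term.
  have h1 : ∀ w, Y (X w) w = ∑ i, (if X w = i then (1 : ℝ) else 0) * Y i w := fun w => by simp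
  have h2 : ∀ i, ∫ w, (if X w = i then (1 : ℝ) else 0) * Y i w ∂P = p * ∫ w, Y i w ∂P := by
    intro i
    have h3 : IndepFun (fun w => if X w = i then (1 : ℝ) else 0) (Y i) P := by
      rw [IndepFun_iff_Indep] at hind ⊢
      refine indep_of_indep_of_le_left (indep_of_indep_of_le_right hind
        (measurable_iff_comap_le.1 (hY i).1)) ?_
      exact measurable_iff_comap_le.1 ((hI i).comp (comap_measurable X))
    rw [h3.integral_fun_mul_eq_mul_integral (hB i).1.aestronglyMeasurable
      (hY' i).1.aestronglyMeasurable, ← hu i]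
    congr 1
    have h4 : (fun w => if X w = i then (1 : ℝ) else 0) = {w | X w = i}.indicator 1 := by
      funext w; simp [Set.indicator_apply]
    rw [h4]
    exact integral_indicator_one (hX (measurableSet_singleton i))
  simp only [h1]
  rw [integral_finsetSum, integral_const_mul, integral_finsetSum, Finset.mul_sum]
  · exact Finset.sum_congr rfl fun i _ => h2 i
  · exact fun i _ => (hY' i).integrable
  · exact fun i _ => ((hB i).comp₂ (hY' i) (q := fun a b => a * b) (by fun_prop)).integrable

end BoundedMeasurable

/-! ### One epoch -/

section Epoch

variable {Ω : Type*} {n d m : ℕ} {f : Fin n → Vec d → ℝ} {T : Fin n → Finset (Fin d)}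
  {L μ : ℝ} {xstar : Vec d} {A : Execution Ω n d m} {ϑ φ η : ℝ} {r s k : ℕ}

theorem continuous_applyD (T : Fin n → Finset (Fin d)) : Continuous (applyD T) := by
  unfold applyD; fun_prop

theorem continuous_mask (s : Finset (Fin d)) : Continuous (mask s) := by
  refine (PiLp.continuous_toLp 2 _).comp (continuous_pi fun v => ?_)
  split_ifs <;> fun_prop

theorem IsProblem.continuous_couple (h : IsProblem f T L μ xstar) :
    Continuous fun p : Vec d × Vec d => couple f T ϑ φ p.1 p.2 := by
  have := (continuous_applyD T).comp (h.continuous_gradient_obj.comp continuous_snd (X := Vec d × Vec d))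
  unfold couple
  exact ((continuous_fst.const_smul ϑ).add (continuous_snd.const_smul (1 - ϑ))).sub
    (this.const_smul φ)

theorem IsProblem.continuous_gradEst (h : IsProblem f T L μ xstar) (i : Fin n) :
    Continuous fun p : Vec d × Vec d => gradEst f T i p.1 p.2 := by
  have := ((continuous_mask (T i)).comp (continuous_applyD T)).comp
    (h.continuous_gradient_obj.comp continuous_snd (X := Vec d × Vec d))
  exact (((h.continuous_gradient i).comp continuous_fst).sub
    ((h.continuous_gradient i).comp continuous_snd)).add this

theorem Execution.boundedMeasurable_yhat (h : IsProblem f T L μ xstar) {mΩ : MeasurableSpace Ω}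
    (hz : BoundedMeasurable mΩ (A.zhat r s k)) (hx : BoundedMeasurable mΩ (A.snap r s)) :
    BoundedMeasurable mΩ (A.yhat f T ϑ φ r s k) :=
  hz.comp₂ hx h.continuous_couple

theorem Execution.boundedMeasurable_grad (h : IsProblem f T L μ xstar) {mΩ : MeasurableSpace Ω}
    (hz : BoundedMeasurable mΩ (A.zhat r s k)) (hx : BoundedMeasurable mΩ (A.snap r s))
    (hi : Measurable[mΩ] (A.sample r s k)) :
    BoundedMeasurable mΩ (A.grad f T ϑ φ r s k) :=
  BoundedMeasurable.select (Y := fun i w => gradEst f T i (A.yhat f T ϑ φ r s k w) (A.snap r s w))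
    hi fun i => (A.boundedMeasurable_yhat h hz hx).comp₂ hx (h.continuous_gradEst i)

theorem Execution.grad_apply_eq_zero (h : IsProblem f T L μ xstar) (w : Ω) {v : Fin d}
    (hv : v ∉ T (A.sample r s k w)) : A.grad f T ϑ φ r s k w v = 0 :=
  h.gradEst_apply_eq_zero _ _ _ hv

/-! ### Boundedness and measurability of the iterates -/

namespace IsRun

variable [mΩ : MeasurableSpace Ω] {P : Measure Ω} {S R τ : ℕ} {x0 : Vec d}

theorem zhat_eq (hA : IsRun P A f T ϑ φ η S R τ x0) (hr : r < R) (hs : s < S) (hk : k < m) (w : Ω) :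
    A.zhat r s k w = A.z r s 0 w - η • ∑ j ∈ Finset.range k,
      mask (A.written r s k j w) (A.grad f T ϑ φ r s j w) := by
  ext v
  rw [hA.read r hr s hs k hk w v]
  simp

theorem z_eq (hA : IsRun P A f T ϑ φ η S R τ x0) (hr : r < R) (hs : s < S) (hk : k ≤ m) (w : Ω) :
    A.z r s k w = A.z r s 0 w - η • ∑ j ∈ Finset.range k, A.grad f T ϑ φ r s j w := by
  induction k with
  | zero => simp
  | succ k ih =>
    rw [hA.z_step r hr s hs k hk, ih (Nat.le_of_succ_le hk), Finset.sum_range_succ, smul_add]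
    abel

/-- The sets `written` are not assumed measurable, so the induction runs over the σ-algebra `⊤` and
yields boundedness alone; measurability of the reads is part of `IsRun`. -/
theorem bounded_zhat (h : IsProblem f T L μ xstar) (hA : IsRun P A f T ϑ φ η S R τ x0)
    (hr : r < R) (hs : s < S) (hx : BoundedMeasurable ⊤ (A.snap r s))
    (hz : BoundedMeasurable ⊤ (A.z r s 0)) (hk : k < m) : BoundedMeasurable ⊤ (A.zhat r s k) := by
  induction k using Nat.strong_induction_on with
  | _ k ih =>
    rw [show A.zhat r s k = _ from funext (hA.zhat_eq hr hs hk)]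
    refine hz.sub (BoundedMeasurable.const_smul η (BoundedMeasurable.sum _ fun j hj => ?_))
    have hj := Finset.mem_range.1 hj
    obtain ⟨C, hC⟩ := (A.boundedMeasurable_grad (ϑ := ϑ) (φ := φ) h (ih j hj (hj.trans hk)) hx
      fun _ _ => trivial).2
    exact ⟨fun _ _ => trivial, C, fun w => (norm_mask_le _ _).trans (hC w)⟩

theorem boundedMeasurable_zhat (h : IsProblem f T L μ xstar) (hA : IsRun P A f T ϑ φ η S R τ x0)
    (hr : r < R) (hs : s < S) (hx : BoundedMeasurable mΩ (A.snap r s))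
    (hz : BoundedMeasurable mΩ (A.z r s 0)) (hk : k < m) : BoundedMeasurable mΩ (A.zhat r s k) :=
  (hA.bounded_zhat h hr hs hx.to_top hz.to_top hk).of_measurable (hA.measurable_zhat r hr s hs k hk)

theorem boundedMeasurable_grad (h : IsProblem f T L μ xstar) (hA : IsRun P A f T ϑ φ η S R τ x0)
    (hr : r < R) (hs : s < S) (hx : BoundedMeasurable mΩ (A.snap r s))
    (hz : BoundedMeasurable mΩ (A.z r s 0)) (hk : k < m) :
    BoundedMeasurable mΩ (A.grad f T ϑ φ r s k) :=
  A.boundedMeasurable_grad h (hA.boundedMeasurable_zhat h hr hs hx hz hk) hx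
    (hA.measurable_sample r hr s hs k hk)

theorem boundedMeasurable_z (h : IsProblem f T L μ xstar) (hA : IsRun P A f T ϑ φ η S R τ x0)
    (hr : r < R) (hs : s < S) (hx : BoundedMeasurable mΩ (A.snap r s))
    (hz : BoundedMeasurable mΩ (A.z r s 0)) (hk : k ≤ m) : BoundedMeasurable mΩ (A.z r s k) := by
  rw [show A.z r s k = _ from funext (hA.z_eq hr hs hk)]
  exact hz.sub (BoundedMeasurable.const_smul η (BoundedMeasurable.sum _ fun j hj =>
    hA.boundedMeasurable_grad h hr hs hx hz ((Finset.mem_range.1 hj).trans_le hk)))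

theorem boundedMeasurable_snap_z (h : IsProblem f T L μ xstar)
    (hA : IsRun P A f T ϑ φ η S R τ x0) (hr : r < R) (hx : BoundedMeasurable mΩ (A.x r))
    (hs : s ≤ S) : BoundedMeasurable mΩ (A.snap r s) ∧ BoundedMeasurable mΩ (A.z r s 0) := by
  induction s with
  | zero =>
    rw [show A.snap r 0 = _ from funext (hA.snap_zero r hr),
      show A.z r 0 0 = _ from funext (hA.z_zero r hr)]
    exact ⟨hx, hx⟩
  | succ s ih =>
    obtain ⟨h1, h2⟩ := ih (Nat.le_of_succ_le hs)
    rw [show A.snap r (s + 1) = _ from funext (hA.snap_succ r hr s hs),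
      show A.z r (s + 1) 0 = _ from funext (hA.z_epoch r hr s hs)]
    exact ⟨BoundedMeasurable.select (Y := fun (i : Fin m) w => A.yhat f T ϑ φ r s i w)
      (hA.measurable_index r hr s hs) fun i => A.boundedMeasurable_yhat h
        (hA.boundedMeasurable_zhat h hr hs h1 h2 i.2) h1,
      hA.boundedMeasurable_z h hr hs h1 h2 le_rfl⟩

theorem boundedMeasurable_x (h : IsProblem f T L μ xstar) (hA : IsRun P A f T ϑ φ η S R τ x0)
    (hr : r ≤ R) : BoundedMeasurable mΩ (A.x r) := by
  induction r with
  | zero =>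
    rw [show A.x 0 = _ from funext hA.init]
    exact BoundedMeasurable.const x0
  | succ r ih =>
    rw [show A.x (r + 1) = _ from funext (hA.restart r hr)]
    exact BoundedMeasurable.const_smul _ (BoundedMeasurable.sum _ fun s hs =>
      (hA.boundedMeasurable_snap_z h hr (ih (Nat.le_of_succ_le hr)) (Finset.mem_range.1 hs)).1)

end IsRun

/-- What is known before the sample `i_k` is drawn: the snapshot, the reads `ẑ_0, …, ẑ_k` and the
samples `i_0, …, i_{k-1}`. -/
def Execution.history (A : Execution Ω n d m) (r s k : ℕ) (w : Ω) :
    Vec d × (Fin (k + 1) → Vec d) × (Fin k → Fin n) :=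
  (A.snap r s w, (fun j : Fin (k + 1) => A.zhat r s j w), (fun j : Fin k => A.sample r s j w))

/-- The σ-algebra generated by the history. -/
abbrev Execution.past (A : Execution Ω n d m) (r s k : ℕ) : MeasurableSpace Ω :=
  MeasurableSpace.comap (A.history r s k) inferInstance

theorem Execution.measurable_snap_past (A : Execution Ω n d m) (r s k : ℕ) :
    Measurable[A.past r s k] (A.snap r s) :=
  measurable_fst.comp (comap_measurable (A.history r s k))

theorem Execution.measurable_zhat_past (A : Execution Ω n d m) (r s : ℕ) {j k : ℕ} (hj : j ≤ k) :
    Measurable[A.past r s k] (A.zhat r s j) :=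
  (((measurable_pi_apply (⟨j, Nat.lt_succ_of_le hj⟩ : Fin (k + 1))).comp measurable_fst).comp
    measurable_snd).comp (comap_measurable (A.history r s k))

theorem Execution.measurable_sample_past (A : Execution Ω n d m) (r s : ℕ) {j k : ℕ} (hj : j < k) :
    Measurable[A.past r s k] (A.sample r s j) :=
  (((measurable_pi_apply (⟨j, hj⟩ : Fin k)).comp measurable_snd).comp
    measurable_snd).comp (comap_measurable (A.history r s k))

/-! ### Expectations over the sample, given the past -/

namespace IsRun

variable [mΩ : MeasurableSpace Ω] {P : Measure Ω} {S R τ : ℕ} {x0 : Vec d}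

theorem measurable_history (hA : IsRun P A f T ϑ φ η S R τ x0) (hr : r < R) (hs : s < S)
    (hk : k < m) (hx : Measurable (A.snap r s)) : Measurable (A.history r s k) :=
  hx.prodMk ((measurable_pi_lambda _ fun j : Fin (k + 1) =>
    hA.measurable_zhat r hr s hs j ((Nat.lt_succ_iff.1 j.2).trans_lt hk)).prodMk
    (measurable_pi_lambda _ fun j : Fin k => hA.measurable_sample r hr s hs j (j.2.trans hk)))

theorem integral_sample [IsFiniteMeasure P] (hA : IsRun P A f T ϑ φ η S R τ x0) (hr : r < R)
    (hs : s < S) (hk : k < m) (hx : Measurable (A.snap r s)) {Y : Fin n → Ω → ℝ}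
    (hY : ∀ i, BoundedMeasurable (A.past r s k) (Y i)) :
    ∫ w, Y (A.sample r s k w) w ∂P = ∫ w, 1 / (n : ℝ) * ∑ i, Y i w ∂P :=
  integral_select (hA.measurable_sample r hr s hs k hk) (hA.measurable_history hr hs hk hx)
    (hA.sample_indep r hr s hs k hk) (hA.sample_uniform r hr s hs k hk) hY

variable (h : IsProblem f T L μ xstar)
  (hA : IsRun P A f T ϑ φ η S R τ x0) (hr : r < R) (hs : s < S)
  (hx : BoundedMeasurable mΩ (A.snap r s)) (hz : BoundedMeasurable mΩ (A.z r s 0))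

section
include h hA hr hs hx hz

theorem boundedMeasurable_zhat_past {j : ℕ} (hk : k < m) (hj : j ≤ k) :
    BoundedMeasurable (A.past r s k) (A.zhat r s j) :=
  (hA.boundedMeasurable_zhat h hr hs hx hz (hj.trans_lt hk)).of_measurable
    (A.measurable_zhat_past r s hj)

theorem boundedMeasurable_grad_past {j : ℕ} (hk : k < m) (hj : j < k) :
    BoundedMeasurable (A.past r s k) (A.grad f T ϑ φ r s j) :=
  A.boundedMeasurable_grad h (hA.boundedMeasurable_zhat_past h hr hs hx hz hk hj.le)
    (hx.of_measurable (A.measurable_snap_past r s k)) (A.measurable_sample_past r s hj)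

variable [IsProbabilityMeasure P]

/-- Unbiasedness of the estimator, tested against vectors known before `i_k` is drawn. -/
theorem integral_inner_grad (hk : k < m) {U : Ω → Vec d} (hU : BoundedMeasurable (A.past r s k) U) :
    ∫ w, inner ℝ (A.grad f T ϑ φ r s k w) (U w) ∂P =
      ∫ w, inner ℝ (gradient (obj f) (A.yhat f T ϑ φ r s k w)) (U w) ∂P := by
  have hx' := hx.of_measurable (A.measurable_snap_past r s k)
  have := hA.integral_sample hr hs hk hx.1 (Y := fun i w =>
    inner ℝ (gradEst f T i (A.yhat f T ϑ φ r s k w) (A.snap r s w)) (U w)) fun i =>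
      boundedMeasurable_inner ((A.boundedMeasurable_yhat h
        (hA.boundedMeasurable_zhat_past h hr hs hx hz hk le_rfl) hx').comp₂ hx'
        (h.continuous_gradEst i)) hU
  simp only [h.avg_inner_gradEst] at this
  exact this

theorem integral_sq_norm_grad (hk : k < m) :
    ∫ w, ‖A.grad f T ϑ φ r s k w‖ ^ 2 ∂P =
      ∫ w, 1 / (n : ℝ) * ∑ i, ‖gradEst f T i (A.yhat f T ϑ φ r s k w) (A.snap r s w)‖ ^ 2 ∂P := by
  have hx' := hx.of_measurable (A.measurable_snap_past r s k)
  exact hA.integral_sample hr hs hk hx.1 (Y := fun i w =>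
    ‖gradEst f T i (A.yhat f T ϑ φ r s k w) (A.snap r s w)‖ ^ 2) fun i =>
      boundedMeasurable_sq_norm ((A.boundedMeasurable_yhat h
        (hA.boundedMeasurable_zhat_past h hr hs hx hz hk le_rfl) hx').comp₂ hx'
        (h.continuous_gradEst i))

/-- For `j < k` the direction `G_j` belongs to the past of `k`, so the mask `T_{i_k}` is drawn
independently of it. This is where the factor `Δ` is gained. -/
theorem integral_sq_norm_mask_grad_le {j : ℕ} (hk : k < m) (hj : j < k) :
    ∫ w, ‖mask (T (A.sample r s k w)) (A.grad f T ϑ φ r s j w)‖ ^ 2 ∂P ≤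
      sparsity T * ∫ w, ‖A.grad f T ϑ φ r s j w‖ ^ 2 ∂P := by
  have hG := hA.boundedMeasurable_grad h hr hs hx hz (hj.trans hk)
  rw [hA.integral_sample hr hs hk hx.1 (Y := fun i w =>
    ‖mask (T i) (A.grad f T ϑ φ r s j w)‖ ^ 2) fun i => boundedMeasurable_sq_norm
      ((hA.boundedMeasurable_grad_past h hr hs hx hz hk hj).comp (continuous_mask (T i))),
    ← integral_const_mul]
  refine integral_mono ?_ ?_ fun w => IsProblem.avg_sq_norm_mask_le T _
  · exact (BoundedMeasurable.sum _ fun i _ => boundedMeasurable_sq_norm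
      (hG.comp (continuous_mask (T i)))).integrable.const_mul _
  · exact (boundedMeasurable_sq_norm hG).integrable.const_mul _

end

end IsRun

end Epoch

end AsyncSVRG

/-! ### Descent over an iteration, an epoch and a round -/

namespace AsyncSVRG

/-- Each index occurs in at most `τ` overlapping pairs as the later member and in at most `τ` as the
earlier one. -/
theorem sum_overlap_le (m τ : ℕ) {e : ℕ → ℝ} (he : ∀ k, 0 ≤ e k) :
    ∑ k ∈ Finset.range m, ∑ j ∈ Finset.range k with k ≤ j + τ, (e k + e j) ≤
      2 * τ * ∑ k ∈ Finset.range m, e k := by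
  simp only [Finset.sum_add_distrib]
  have h1 : ∑ k ∈ Finset.range m, ∑ j ∈ Finset.range k with k ≤ j + τ, e k ≤
      ∑ k ∈ Finset.range m, τ * e k := by
    refine Finset.sum_le_sum fun k _ => ?_
    rw [Finset.sum_const, nsmul_eq_mul]
    refine mul_le_mul_of_nonneg_right (Nat.cast_le.2 ?_) (he k)
    refine (Finset.card_le_card (t := Finset.Ico (k - τ) k) fun j hj => ?_).trans
      (by rw [Nat.card_Ico]; omega)
    simp only [Finset.mem_filter, Finset.mem_range, Finset.mem_Ico] at hj ⊢
    omega
  have h2 : ∑ k ∈ Finset.range m, ∑ j ∈ Finset.range k with k ≤ j + τ, e j ≤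
      ∑ j ∈ Finset.range m, τ * e j := by
    rw [Finset.sum_comm' (t' := Finset.range m)
      (s' := fun j => {k ∈ Finset.range m | j < k ∧ k ≤ j + τ})
      (by simp only [Finset.mem_filter, Finset.mem_range]; omega)]
    refine Finset.sum_le_sum fun j _ => ?_
    rw [Finset.sum_const, nsmul_eq_mul]
    refine mul_le_mul_of_nonneg_right (Nat.cast_le.2 ?_) (he j)
    refine (Finset.card_le_card (t := Finset.Ioc j (j + τ)) fun k hk => ?_).trans (by simp)
    simp only [Finset.mem_filter, Finset.mem_range, Finset.mem_Ioc] at hk ⊢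
    omega
  rw [← Finset.mul_sum] at h1 h2
  linarith

section Descent

variable {Ω : Type*} {n d m : ℕ} {f : Fin n → Vec d → ℝ} {T : Fin n → Finset (Fin d)}
  {L μ : ℝ} {xstar : Vec d} {A : Execution Ω n d m} {ϑ φ η : ℝ} {r s k : ℕ}
  [mΩ : MeasurableSpace Ω] {P : Measure Ω} {S R τ : ℕ} {x0 : Vec d}

namespace IsRun

theorem inner_grad_zhat_le (h : IsProblem f T L μ xstar) (hA : IsRun P A f T ϑ φ η S R τ x0)
    (hr : r < R) (hs : s < S) (hk : k < m) (hη : 0 < η) {δ : ℝ} (hδ : 0 < δ) (x : Vec d) (w : Ω) :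
    inner ℝ (A.grad f T ϑ φ r s k w) (A.zhat r s k w - x) ≤
      1 / (2 * η) * (‖A.z r s k w - x‖ ^ 2 - ‖A.z r s (k + 1) w - x‖ ^ 2) +
      η / 2 * ‖A.grad f T ϑ φ r s k w‖ ^ 2 +
      η * ∑ j ∈ Finset.range k with k ≤ j + τ, (δ / 2 * ‖A.grad f T ϑ φ r s k w‖ ^ 2 +
        1 / (2 * δ) * ‖mask (T (A.sample r s k w)) (A.grad f T ϑ φ r s j w)‖ ^ 2) := by
  set G := fun j => A.grad f T ϑ φ r s j w with hG
  have e1 : A.zhat r s k w - x = (A.z r s k w - x) +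
      η • ∑ j ∈ Finset.range k, (G j - mask (A.written r s k j w) (G j)) := by
    rw [hA.zhat_eq hr hs hk, hA.z_eq hr hs hk.le, Finset.sum_sub_distrib, smul_sub]
    abel
  have e2 : ‖A.z r s (k + 1) w - x‖ ^ 2 =
      ‖A.z r s k w - x‖ ^ 2 - 2 * η * inner ℝ (G k) (A.z r s k w - x) + η ^ 2 * ‖G k‖ ^ 2 := by
    rw [hA.z_step r hr s hs k hk, sub_right_comm, norm_sub_sq_real, norm_smul, inner_smul_right,
      real_inner_comm, mul_pow, Real.norm_eq_abs, sq_abs]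
    ring
  -- Iterations with `j + τ < k` are fully visible to read `k` because `G_j` is supported in
  -- `T_{i_j}`, so their terms vanish.
  have e3 : ∑ j ∈ Finset.range k with k ≤ j + τ,
      inner ℝ (G k) (G j - mask (A.written r s k j w) (G j)) =
      ∑ j ∈ Finset.range k, inner ℝ (G k) (G j - mask (A.written r s k j w) (G j)) := by
    refine Finset.sum_filter_of_ne fun j _ hne => ?_
    by_contra hlt
    have hsub := hA.overlap r hr s hs k hk j (not_le.1 hlt) w
    refine hne ?_
    have : mask (A.written r s k j w) (G j) = G j := by
      ext v
      rw [mask_apply, ite_eq_left_iff]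
      exact fun hv => (A.grad_apply_eq_zero h w fun hT => hv (hsub hT)).symm
    rw [this, sub_self, inner_zero_right]
  have e4 : ∀ j, inner ℝ (G k) (G j - mask (A.written r s k j w) (G j)) ≤
      δ / 2 * ‖G k‖ ^ 2 + 1 / (2 * δ) * ‖mask (T (A.sample r s k w)) (G j)‖ ^ 2 := by
    intro j
    refine (inner_le_norm_mul_norm_mask (s := T (A.sample r s k w)) (z := G j)
      (fun v hv => A.grad_apply_eq_zero h w hv) fun v => ?_).trans ?_
    · by_cases hv : v ∈ A.written r s k j w <;> simp [hv]
    · set a := ‖G k‖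
      set b := ‖mask (T (A.sample r s k w)) (G j)‖
      have : δ / 2 * a ^ 2 + 1 / (2 * δ) * b ^ 2 - a * b = (δ * a - b) ^ 2 / (2 * δ) := by
        field_simp; ring
      have : 0 ≤ (δ * a - b) ^ 2 / (2 * δ) := by positivity
      linarith
  rw [e1, inner_add_right, inner_smul_right, inner_sum, ← e3, e2]
  refine add_le_add (le_of_eq ?_)
    (mul_le_mul_of_nonneg_left (Finset.sum_le_sum fun j _ => e4 j) hη.le)
  field_simp
  ring

variable [IsProbabilityMeasure P]

theorem integral_inner_grad_zhat_le (h : IsProblem f T L μ xstar)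
    (hA : IsRun P A f T ϑ φ η S R τ x0) (hr : r < R) (hs : s < S)
    (hx : BoundedMeasurable mΩ (A.snap r s)) (hz : BoundedMeasurable mΩ (A.z r s 0))
    (hk : k < m) (hη : 0 < η) (hΔ : 0 < sparsity T) (x : Vec d) :
    ∫ w, inner ℝ (A.grad f T ϑ φ r s k w) (A.zhat r s k w - x) ∂P ≤
      1 / (2 * η) * (∫ w, ‖A.z r s k w - x‖ ^ 2 ∂P - ∫ w, ‖A.z r s (k + 1) w - x‖ ^ 2 ∂P) +
      η / 2 * ∫ w, ‖A.grad f T ϑ φ r s k w‖ ^ 2 ∂P +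
      η * (√(sparsity T) / 2 * ∑ j ∈ Finset.range k with k ≤ j + τ,
        (∫ w, ‖A.grad f T ϑ φ r s k w‖ ^ 2 ∂P + ∫ w, ‖A.grad f T ϑ φ r s j w‖ ^ 2 ∂P)) := by
  -- This weight in Young's inequality balances the two terms: `Δ / (2δ) = δ / 2`.
  set δ := √(sparsity T) with hδdef
  have hδ : 0 < δ := Real.sqrt_pos.2 hΔ
  have hc := BoundedMeasurable.const (mΩ := mΩ) x
  have hG := fun {j} (hj : j < m) => hA.boundedMeasurable_grad h hr hs hx hz hj
  have i1 := (boundedMeasurable_sq_norm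
    ((hA.boundedMeasurable_z h hr hs hx hz hk.le).sub hc)).integrable (P := P)
  have i2 := (boundedMeasurable_sq_norm
    ((hA.boundedMeasurable_z h hr hs hx hz hk).sub hc)).integrable (P := P)
  have i3 := (boundedMeasurable_sq_norm (hG hk)).integrable (P := P)
  have i4 : ∀ j ∈ {j ∈ Finset.range k | k ≤ j + τ}, Integrable
      (fun w => ‖mask (T (A.sample r s k w)) (A.grad f T ϑ φ r s j w)‖ ^ 2) P := fun j hj => by
    have hj := (Finset.mem_range.1 (Finset.mem_filter.1 hj).1).trans hk
    exact (boundedMeasurable_sq_norm (BoundedMeasurable.select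
      (Y := fun i w => mask (T i) (A.grad f T ϑ φ r s j w)) (hA.measurable_sample r hr s hs k hk)
      fun i => (hG hj).comp (continuous_mask _))).integrable
  have i5 : ∀ j ∈ {j ∈ Finset.range k | k ≤ j + τ}, Integrable
      (fun w => δ / 2 * ‖A.grad f T ϑ φ r s k w‖ ^ 2 +
        1 / (2 * δ) * ‖mask (T (A.sample r s k w)) (A.grad f T ϑ φ r s j w)‖ ^ 2) P :=
    fun j hj => (i3.const_mul _).add ((i4 j hj).const_mul _)
  have i6 := ((i1.sub i2).const_mul (1 / (2 * η))).add (i3.const_mul (η / 2))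
  have i7 := (integrable_finsetSum _ i5).const_mul η
  have i8 := (boundedMeasurable_inner (hG hk)
    ((hA.boundedMeasurable_zhat h hr hs hx hz hk).sub hc)).integrable (P := P)
  refine (integral_mono i8 (i6.add i7) fun w =>
    hA.inner_grad_zhat_le h hr hs hk hη hδ x w).trans ?_
  rw [integral_add' i6 i7, integral_add' ((i1.sub i2).const_mul _) (i3.const_mul _),
    integral_const_mul, integral_const_mul, integral_const_mul, integral_sub' i1 i2,
    integral_finsetSum _ i5, Finset.mul_sum (a := δ / 2)]
  gcongr with j hj
  rw [integral_add (i3.const_mul _) ((i4 j hj).const_mul _), integral_const_mul,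
    integral_const_mul, mul_add]
  have hjk := Finset.mem_range.1 (Finset.mem_filter.1 hj).1
  have := hA.integral_sq_norm_mask_grad_le h hr hs hx hz hk hjk
  rw [← Real.sq_sqrt hΔ.le, ← hδdef] at this
  refine add_le_add le_rfl ((mul_le_mul_of_nonneg_left this (by positivity)).trans (le_of_eq ?_))
  field_simp

/-- The expectation of `couple_progress`, with `∇f(ŷ_k)` traded for `G_k` by unbiasedness; this is
allowed since `ẑ_k` is known before `i_k`. -/
theorem step (h : IsProblem f T L μ xstar)
    (hA : IsRun P A f T ϑ (phi L ϑ) η S R τ x0) (hr : r < R) (hs : s < S)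
    (hx : BoundedMeasurable mΩ (A.snap r s)) (hz : BoundedMeasurable mΩ (A.z r s 0))
    (hk : k < m) (h0 : 0 < ϑ) (h1 : ϑ < 1) :
    1 / ϑ * (∫ w, obj f (A.yhat f T ϑ (phi L ϑ) r s k w) ∂P - obj f xstar) ≤
      (1 - ϑ) / ϑ * (∫ w, obj f (A.snap r s w) ∂P - obj f xstar) -
      (1 - ϑ) / (2 * L * ϑ) * ∫ w, ‖A.grad f T ϑ (phi L ϑ) r s k w‖ ^ 2 ∂P +
      ∫ w, inner ℝ (A.grad f T ϑ (phi L ϑ) r s k w) (A.zhat r s k w - xstar) ∂P := by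
  have hc := h.differentiable_obj.continuous
  have hzh := hA.boundedMeasurable_zhat h hr hs hx hz hk
  have hy : BoundedMeasurable mΩ (A.yhat f T ϑ (phi L ϑ) r s k) := A.boundedMeasurable_yhat h hzh hx
  rw [hA.integral_inner_grad h hr hs hx hz hk
    ((hA.boundedMeasurable_zhat_past h hr hs hx hz hk le_rfl).sub (BoundedMeasurable.const xstar)),
    hA.integral_sq_norm_grad h hr hs hx hz hk]
  have i1 := (hy.comp hc).integrable (P := P)
  have i2 := (hx.comp hc).integrable (P := P)
  have i3 : Integrable (fun w => 1 / (n : ℝ) * ∑ i, ‖gradEst f T i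
      (A.yhat f T ϑ (phi L ϑ) r s k w) (A.snap r s w)‖ ^ 2) P :=
    (BoundedMeasurable.sum _ fun i _ => boundedMeasurable_sq_norm
      (hy.comp₂ hx (h.continuous_gradEst i))).integrable.const_mul _
  have i4 := (boundedMeasurable_inner (hy.comp h.continuous_gradient_obj)
    (hzh.sub (BoundedMeasurable.const xstar))).integrable (P := P)
  have c := integrable_const (μ := P) (obj f xstar)
  have key := integral_mono ((i1.sub c).const_mul (1 / ϑ))
    ((((i2.sub c).const_mul ((1 - ϑ) / ϑ)).sub (i3.const_mul ((1 - ϑ) / (2 * L * ϑ)))).add i4)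
    fun w => h.couple_progress h0 h1 (A.zhat r s k w) (A.snap r s w)
      (y := A.yhat f T ϑ (phi L ϑ) r s k w) rfl
  rw [integral_add' (((i2.sub c).const_mul _).sub (i3.const_mul _)) i4,
    integral_sub' ((i2.sub c).const_mul _) (i3.const_mul _), integral_const_mul,
    integral_const_mul, integral_const_mul, integral_sub' i1 c, integral_sub' i2 c] at key
  simpa using key

theorem integral_obj_snap_succ (h : IsProblem f T L μ xstar)
    (hA : IsRun P A f T ϑ φ η S R τ x0) (hr : r < R) (hs : s < S)
    (hx : BoundedMeasurable mΩ (A.snap r s)) (hz : BoundedMeasurable mΩ (A.z r s 0)) :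
    ∫ w, obj f (A.snap r (s + 1) w) ∂P =
      1 / (m : ℝ) * ∑ k ∈ Finset.range m, ∫ w, obj f (A.yhat f T ϑ φ r s k w) ∂P := by
  have hc := h.differentiable_obj.continuous
  have hy : ∀ k : Fin m, BoundedMeasurable mΩ (A.yhat f T ϑ φ r s k) := fun k =>
    A.boundedMeasurable_yhat h (hA.boundedMeasurable_zhat h hr hs hx hz k.2) hx
  simp only [hA.snap_succ r hr s hs]
  rw [integral_select (hA.measurable_index r hr s hs)
    (measurable_pi_lambda _ fun k : Fin m => (hy k).1) (hA.index_indep r hr s hs)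
    (hA.index_uniform r hr s hs) (Y := fun k w => obj f (A.yhat f T ϑ φ r s k w)) fun k =>
      ((hy k).comp hc).of_measurable (hc.measurable.comp ((measurable_pi_apply k).comp
        (comap_measurable (fun w => fun k : Fin m => A.yhat f T ϑ φ r s k w)))),
    integral_const_mul, integral_finsetSum _ fun k _ => ((hy k).comp hc).integrable,
    Finset.sum_range fun k => ∫ w, obj f (A.yhat f T ϑ φ r s k w) ∂P]

theorem epoch (h : IsProblem f T L μ xstar) {ρ : ℝ}
    (hA : IsRun P A f T ϑ (phi L ϑ) (eta L ϑ ρ) S R τ x0) (hr : r < R) (hs : s < S)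
    (hx : BoundedMeasurable mΩ (A.snap r s)) (hz : BoundedMeasurable mΩ (A.z r s 0))
    (h0 : 0 < ϑ) (h1 : ϑ < 1) (hΔ : 0 < sparsity T) (hm : 0 < m)
    (hρ : 1 + 2 * √(sparsity T) * τ ≤ ρ) :
    1 / ϑ * (∫ w, obj f (A.snap r (s + 1) w) ∂P - obj f xstar) ≤
      (1 - ϑ) / ϑ * (∫ w, obj f (A.snap r s w) ∂P - obj f xstar) +
      1 / (2 * eta L ϑ ρ * m) * (∫ w, ‖A.z r s 0 w - xstar‖ ^ 2 ∂P -
        ∫ w, ‖A.z r (s + 1) 0 w - xstar‖ ^ 2 ∂P) := by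
  have hL := h.L_pos
  have hm' : (0 : ℝ) < m := Nat.cast_pos.2 hm
  have hρ0 : 0 < ρ := lt_of_lt_of_le (by positivity) hρ
  set η := eta L ϑ ρ with hηdef
  have hη : 0 < η := div_pos (by linarith) (by positivity)
  -- The step size is chosen so that the available negative term is exactly `ρ` times the cost `η /
  -- 2` of a synchronous step.
  have hηρ : (1 - ϑ) / (2 * L * ϑ) = η / 2 * ρ := by
    rw [hηdef, eta]; field_simp
  set e := fun k => ∫ w, ‖A.grad f T ϑ (phi L ϑ) r s k w‖ ^ 2 ∂P with he
  set q := fun k => ∫ w, ‖A.z r s k w - xstar‖ ^ 2 ∂P with hq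
  set a := fun k => ∫ w, obj f (A.yhat f T ϑ (phi L ϑ) r s k w) ∂P with ha
  set b := ∫ w, obj f (A.snap r s w) ∂P with hb
  obtain ⟨O, hO⟩ : ∃ O : ℕ → ℝ, ∀ k, O k = ∑ j ∈ Finset.range k with k ≤ j + τ, (e k + e j) :=
    ⟨_, fun _ => rfl⟩
  have hstep : ∀ k ∈ Finset.range m, 1 / ϑ * (a k - obj f xstar) ≤
      (1 - ϑ) / ϑ * (b - obj f xstar) - η / 2 * ρ * e k + (1 / (2 * η) * (q k - q (k + 1)) +
      η / 2 * e k + η * (√(sparsity T) / 2 * O k)) := fun k hk => by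
    have hk := Finset.mem_range.1 hk
    have e1 := hA.step h hr hs hx hz hk h0 h1
    have e2 := hA.integral_inner_grad_zhat_le h hr hs hx hz hk hη hΔ xstar
    rw [hηρ] at e1
    rw [hO]
    exact e1.trans (add_le_add le_rfl e2)
  have hsum := Finset.sum_le_sum hstep
  simp only [Finset.sum_add_distrib, Finset.sum_sub_distrib, ← Finset.mul_sum, Finset.sum_const,
    Finset.card_range, nsmul_eq_mul] at hsum
  have htel : ∑ k ∈ Finset.range m, q k - ∑ k ∈ Finset.range m, q (k + 1) = q 0 - q m := by
    rw [← Finset.sum_sub_distrib, Finset.sum_range_sub']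
  rw [htel] at hsum
  have he0 : ∀ k, 0 ≤ e k := fun k => integral_nonneg fun w => by positivity
  have hov := sum_overlap_le m τ he0
  simp only [← hO] at hov
  set E := ∑ k ∈ Finset.range m, e k with hE
  have hE0 : 0 ≤ E := Finset.sum_nonneg fun k _ => he0 k
  have e1 : η * (√(sparsity T) / 2 * ∑ k ∈ Finset.range m, O k) ≤
      η * (√(sparsity T) / 2 * (2 * τ * E)) := by gcongr
  have e2 : η / 2 * ((1 + 2 * √(sparsity T) * τ) * E) ≤ η / 2 * (ρ * E) := by gcongr
  have hmain : 1 / ϑ * (∑ k ∈ Finset.range m, a k - m * obj f xstar) ≤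
      m * ((1 - ϑ) / ϑ * (b - obj f xstar)) + 1 / (2 * η) * (q 0 - q m) := by
    linarith
  rw [hA.integral_obj_snap_succ h hr hs hx hz]
  simp only [hA.z_epoch r hr s hs]
  change 1 / ϑ * (1 / (m : ℝ) * ∑ k ∈ Finset.range m, a k - obj f xstar) ≤
    (1 - ϑ) / ϑ * (b - obj f xstar) + 1 / (2 * η * m) * (q 0 - q m)
  have := mul_le_mul_of_nonneg_left hmain (one_div_pos.2 hm').le
  calc _ = 1 / (m : ℝ) * (1 / ϑ * (∑ k ∈ Finset.range m, a k - m * obj f xstar)) := by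
        field_simp
    _ ≤ _ := this
    _ = _ := by field_simp

theorem round (h : IsProblem f T L μ xstar) {ρ : ℝ}
    (hA : IsRun P A f T ϑ (phi L ϑ) (eta L ϑ ρ) S R τ x0) (hr : r < R) (hS : 0 < S)
    (h0 : 0 < ϑ) (h1 : ϑ < 1) (hΔ : 0 < sparsity T) (hm : 0 < m)
    (hρ : 1 + 2 * √(sparsity T) * τ ≤ ρ) :
    ∫ w, obj f (A.x (r + 1) w) ∂P - obj f xstar ≤
      1 / (S : ℝ) * ((1 - ϑ) / ϑ + 1 / (eta L ϑ ρ * m * μ)) *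
        (∫ w, obj f (A.x r w) ∂P - obj f xstar) := by
  have hL := h.L_pos
  have hμ := h.mu_pos
  have hm' : (0 : ℝ) < m := Nat.cast_pos.2 hm
  have hS' : (0 : ℝ) < S := Nat.cast_pos.2 hS
  have hρ0 : 0 < ρ := lt_of_lt_of_le (by positivity) hρ
  have hη : 0 < eta L ϑ ρ := div_pos (by linarith) (by positivity)
  set η := eta L ϑ ρ with hηdef
  have hc := h.differentiable_obj.continuous
  have hxr := hA.boundedMeasurable_x h hr.le
  have hB := fun {s} (hs : s ≤ S) => hA.boundedMeasurable_snap_z h hr hxr hs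
  set a := fun s => ∫ w, obj f (A.snap r s w) ∂P - obj f xstar with ha
  set b := fun s => ∫ w, ‖A.z r s 0 w - xstar‖ ^ 2 ∂P with hb
  have hobj : ∀ x, 0 ≤ obj f x - obj f xstar := fun x =>
    le_trans (by positivity) (h.growth x)
  have ha0 : ∀ s ≤ S, 0 ≤ a s := fun s hs => by
    have i1 := ((hB hs).1.comp hc).integrable (P := P)
    have : a s = ∫ w, (obj f (A.snap r s w) - obj f xstar) ∂P := by
      rw [integral_sub i1 (integrable_const _)]; simp [ha]
    rw [this]
    exact integral_nonneg fun w => hobj _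
  have hepoch : ∀ s ∈ Finset.range S, 1 / ϑ * a (s + 1) ≤
      (1 - ϑ) / ϑ * a s + 1 / (2 * η * m) * (b s - b (s + 1)) := fun s hs => by
    have hs := Finset.mem_range.1 hs
    exact hA.epoch h hr hs (hB hs.le).1 (hB hs.le).2 h0 h1 hΔ hm hρ
  have hsum := Finset.sum_le_sum hepoch
  simp only [Finset.sum_add_distrib, ← Finset.mul_sum, Finset.sum_range_sub'] at hsum
  -- With `1 / ϑ = 1 + (1 - ϑ) / ϑ`, shifting the sum leaves `∑ a (s + 1)` with coefficient one and
  -- only boundary terms beside it.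
  have hshift : ∑ s ∈ Finset.range S, a s = ∑ s ∈ Finset.range S, a (s + 1) + a 0 - a S := by
    have := Finset.sum_range_succ a S
    rw [Finset.sum_range_succ'] at this
    linarith
  have hbS : 0 ≤ b S := integral_nonneg fun w => by positivity
  have hax : a 0 = ∫ w, obj f (A.x r w) ∂P - obj f xstar := by
    simp only [ha, hA.snap_zero r hr]
  have hb0 : b 0 ≤ 2 / μ * a 0 := by
    have i1 := (hxr.comp hc).integrable (P := P)
    have i2 := (boundedMeasurable_sq_norm
      (hxr.sub (BoundedMeasurable.const xstar))).integrable (P := P)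
    have : 2 / μ * a 0 = ∫ w, 2 / μ * (obj f (A.x r w) - obj f xstar) ∂P := by
      rw [integral_const_mul, integral_sub i1 (integrable_const _), hax]; simp
    rw [this]
    simp only [hb, hA.z_zero r hr]
    refine integral_mono i2 ((i1.sub (integrable_const _)).const_mul _) fun w => ?_
    have := mul_le_mul_of_nonneg_left (h.growth (A.x r w)) (div_pos two_pos hμ).le
    refine le_trans (le_of_eq ?_) this
    field_simp
  have hsumle : ∑ s ∈ Finset.range S, a (s + 1) ≤
      ((1 - ϑ) / ϑ + 1 / (η * m * μ)) * a 0 := by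
    have e1 : 1 / (2 * η * m) * b 0 ≤ 1 / (2 * η * m) * (2 / μ * a 0) := by gcongr
    have e2 : 0 ≤ 1 / (2 * η * m) * b S := by positivity
    have e3 : 0 ≤ (1 - ϑ) / ϑ * a S := mul_nonneg (div_nonneg (by linarith) h0.le) (ha0 S le_rfl)
    have e4 : 1 / (2 * η * m) * (2 / μ * a 0) = 1 / (η * m * μ) * a 0 := by field_simp
    have e5 : 1 / ϑ = 1 + (1 - ϑ) / ϑ := by field_simp; ring
    rw [hshift, e5] at hsum
    linarith
  have hconv : ∫ w, obj f (A.x (r + 1) w) ∂P - obj f xstar ≤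
      1 / (S : ℝ) * ∑ s ∈ Finset.range S, a (s + 1) := by
    have i1 := ((hA.boundedMeasurable_x h hr).comp hc).integrable (P := P)
    have i2 : ∀ s ∈ Finset.range S, Integrable (fun w => obj f (A.snap r (s + 1) w)) P :=
      fun s hs => ((hB (Finset.mem_range.1 hs)).1.comp hc).integrable
    have e1 : ∫ w, obj f (A.x (r + 1) w) ∂P ≤
        ∫ w, 1 / (S : ℝ) * ∑ s ∈ Finset.range S, obj f (A.snap r (s + 1) w) ∂P := by
      refine integral_mono i1 ((integrable_finsetSum _ i2).const_mul _) fun w => ?_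
      have := h.convexOn_obj.map_sum_le (t := Finset.range S) (w := fun _ => 1 / (S : ℝ))
        (p := fun s => A.snap r (s + 1) w) (fun _ _ => by positivity) (by simp [hS'.ne'])
        (fun _ _ => Set.mem_univ _)
      rw [← Finset.smul_sum] at this
      simp only [hA.restart r hr, Finset.mul_sum]
      exact this
    rw [integral_const_mul, integral_finsetSum _ i2] at e1
    have e2 : 1 / (S : ℝ) * ∑ s ∈ Finset.range S, a (s + 1) = 1 / (S : ℝ) *
        ∑ s ∈ Finset.range S, ∫ w, obj f (A.snap r (s + 1) w) ∂P - obj f xstar := by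
      simp only [ha, Finset.sum_sub_distrib, Finset.sum_const, Finset.card_range, nsmul_eq_mul]
      field_simp
    rw [e2]
    linarith
  rw [← hax, mul_assoc]
  exact hconv.trans (mul_le_mul_of_nonneg_left hsumle (by positivity))

end IsRun

end Descent

end AsyncSVRG

namespace AsyncSVRG

/-! ### The choice of parameters -/

section Parameters

variable {κ ρ : ℝ} {m : ℕ}

theorem theta_pos (hκ : 0 < κ) (hρ : 0 < ρ) (hm : 0 < m) : 0 < theta κ ρ m := by
  have : (0 : ℝ) < m := Nat.cast_pos.2 hm
  unfold theta; positivity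

theorem one_sub_theta (hm : 0 < m) :
    1 - theta κ ρ m = √(κ * ρ) / (√(κ * ρ) + √(m : ℝ)) := by
  have : (0 : ℝ) < m := Nat.cast_pos.2 hm
  have : (0 : ℝ) < √(κ * ρ) + √(m : ℝ) := by positivity
  unfold theta; field_simp; ring

theorem theta_lt_one (hκ : 0 < κ) (hρ : 0 < ρ) (hm : 0 < m) : theta κ ρ m < 1 := by
  have : (0 : ℝ) < m := Nat.cast_pos.2 hm
  rw [← sub_pos, one_sub_theta hm]
  positivity

theorem one_sub_theta_div_theta (hκ : 0 < κ) (hρ : 0 < ρ) (hm : 0 < m) :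
    (1 - theta κ ρ m) / theta κ ρ m = √(κ / m * ρ) := by
  have : (0 : ℝ) < m := Nat.cast_pos.2 hm
  have h1 : (0 : ℝ) < √(κ * ρ) + √(m : ℝ) := by positivity
  rw [one_sub_theta hm, theta, div_div_div_cancel_right₀ h1.ne', div_mul_eq_mul_div,
    Real.sqrt_div' _ this.le]

/-- The value of `ϑ` makes the two parts of the contraction factor equal: this is the same square
root as in `one_sub_theta_div_theta`. -/
theorem one_div_eta {L μ : ℝ} (hL : 0 < L) (hμ : 0 < μ) (hρ : 0 < ρ) (hm : 0 < m) :
    1 / (eta L (theta (L / μ) ρ m) ρ * m * μ) = √(L / μ / m * ρ) := by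
  have hm' : (0 : ℝ) < m := Nat.cast_pos.2 hm
  have hκ : 0 < L / μ := div_pos hL hμ
  have e : eta L (theta (L / μ) ρ m) ρ = √(L / μ / m * ρ) / (L * ρ) := by
    rw [← one_sub_theta_div_theta hκ hρ hm, eta]
    have := theta_pos hκ hρ hm
    field_simp
  have hs : 0 < √(L / μ / m * ρ) := by positivity
  have hsq := Real.sq_sqrt (show 0 ≤ L / μ / m * ρ by positivity)
  set x := √(L / μ / m * ρ)
  rw [e, div_eq_iff (by positivity)]
  calc (1 : ℝ) = (L / μ / m * ρ) * (m * μ / (L * ρ)) := by field_simp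
    _ = _ := by rw [← hsq]; ring

theorem epochs_pos {ω : ℝ} (hω : 0 < ω) (hκ : 0 < κ) (hρ : 0 < ρ) (hm : 0 < m) :
    0 < epochs ω κ ρ m := by
  have : (0 : ℝ) < m := Nat.cast_pos.2 hm
  exact Nat.ceil_pos.2 (by positivity)

theorem contraction_factor_le {ω L μ : ℝ} (hω : 0 < ω) (hL : 0 < L) (hμ : 0 < μ) (hρ : 0 < ρ)
    (hm : 0 < m) :
    1 / (epochs ω (L / μ) ρ m : ℝ) * ((1 - theta (L / μ) ρ m) / theta (L / μ) ρ m +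
      1 / (eta L (theta (L / μ) ρ m) ρ * m * μ)) ≤ 1 / ω := by
  have hκ : 0 < L / μ := div_pos hL hμ
  rw [one_div_eta hL hμ hρ hm, one_sub_theta_div_theta hκ hρ hm]
  have hS : (0 : ℝ) < epochs ω (L / μ) ρ m := Nat.cast_pos.2 (epochs_pos hω hκ hρ hm)
  have hle : 2 * ω * √(L / μ / m * ρ) ≤ epochs ω (L / μ) ρ m := Nat.le_ceil _
  rw [one_div_mul_eq_div, div_le_div_iff₀ hS hω]
  linarith

theorem sqrt_mul_le_of_le {Δ c τ M : ℝ} (hc : 0 ≤ c) (hM : 0 ≤ M) (hτ : τ ≤ c * (1 / √Δ * M)) :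
    √Δ * τ ≤ c * M := by
  calc √Δ * τ ≤ √Δ * (c * (1 / √Δ * M)) := by gcongr
    _ = (√Δ * (√Δ)⁻¹) * (c * M) := by ring
    -- An inequality rather than an equality, so that `Δ = 0` is included.
    _ ≤ 1 * (c * M) := by gcongr; exact mul_inv_le_one
    _ = _ := one_mul _

theorem sqrt_max_one_le (q : ℝ) : √(max 1 q) ≤ max 1 √q := by
  rcases le_total 1 q with h | h
  · rw [max_eq_right h]; exact le_max_right _ _
  · rw [max_eq_left h, Real.sqrt_one]; exact le_max_left _ _

theorem epochs_le {ω c₁ c N : ℝ} (hω : 0 ≤ ω) (hc₁ : 0 < c₁) (hc : 0 ≤ c) (hN : 0 < N)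
    (hκ : 0 < κ) (hm : c₁ * N ≤ m) (hρ : ρ ≤ 1 + 2 * (c * max (N / κ) 1)) :
    (epochs ω κ ρ m : ℝ) ≤ (2 * ω * √((1 + 2 * c) / c₁) + 1) * max 1 √(κ / N) := by
  have hq : 0 < κ / N := by positivity
  -- The overlap bound has exactly the form for which `κρ/m` stays of order `max 1 (κ / N)`.
  have e1 : κ / N * max (N / κ) 1 = max 1 (κ / N) := by
    rw [mul_max_of_nonneg _ _ hq.le, mul_one]
    congr 1
    field_simp
  have e2 : κ / m * ρ ≤ (1 + 2 * c) / c₁ * max 1 (κ / N) := by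
    calc κ / m * ρ ≤ κ / m * (1 + 2 * (c * max (N / κ) 1)) := by gcongr
      _ ≤ κ / (c₁ * N) * (1 + 2 * (c * max (N / κ) 1)) := by
        have : 0 ≤ max (N / κ) 1 := zero_le_one.trans (le_max_right _ _)
        gcongr
      _ = 1 / c₁ * (κ / N + 2 * c * (κ / N * max (N / κ) 1)) := by field_simp
      _ ≤ 1 / c₁ * (max 1 (κ / N) + 2 * c * max 1 (κ / N)) := by
        rw [e1]
        gcongr
        exact le_max_right _ _
      _ = _ := by ring
  have e3 : √(κ / m * ρ) ≤ √((1 + 2 * c) / c₁) * max 1 √(κ / N) := by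
    refine (Real.sqrt_le_sqrt e2).trans ?_
    rw [Real.sqrt_mul (by positivity)]
    exact mul_le_mul_of_nonneg_left (sqrt_max_one_le _) (Real.sqrt_nonneg _)
  have e4 := (Nat.ceil_lt_add_one (show 0 ≤ 2 * ω * √(κ / m * ρ) by positivity)).le
  calc (epochs ω κ ρ m : ℝ) ≤ 2 * ω * √(κ / m * ρ) + 1 := e4
    _ ≤ 2 * ω * (√((1 + 2 * c) / c₁) * max 1 √(κ / N)) + max 1 √(κ / N) := by
      gcongr
      exact le_max_left _ _
    _ = _ := by ring

theorem mul_max_one_sqrt_div {N : ℝ} (hN : 0 < N) : N * max 1 √(κ / N) = max N √(κ * N) := by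
  rw [mul_max_of_nonneg _ _ hN.le, mul_one]
  congr 1
  nth_rewrite 1 [← Real.sqrt_sq hN.le]
  rw [← Real.sqrt_mul (sq_nonneg N)]
  congr 1
  field_simp

theorem oracleCalls_eq (n m S R : ℕ) : oracleCalls n m S R = R * S * (n + 2 * m) := by
  simp [oracleCalls]; ring

theorem mul_inv_pow_le {ω D ε : ℝ} {R : ℕ} (hω : 1 < ω) (hD : 0 ≤ D) (hε : 0 < ε)
    (hR : Real.log (D / ε) / Real.log ω ≤ R) : (1 / ω) ^ R * D ≤ ε := by
  -- For `D = 0` the logarithm takes its default value `0` and carries no information, but the claim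
  -- is trivial.
  rcases hD.eq_or_lt with rfl | hD
  · simpa using hε.le
  have hω0 : 0 < ω := one_pos.trans hω
  have h1 : D / ε ≤ ω ^ R := by
    rw [div_le_iff₀ (Real.log_pos hω), ← Real.log_pow] at hR
    exact (Real.log_le_log_iff (by positivity) (by positivity)).1 hR
  rw [div_le_iff₀ hε] at h1
  rw [one_div, inv_pow, inv_mul_le_iff₀ (by positivity)]
  exact h1

end Parameters

/-! ### Linear convergence over the rounds -/

theorem IsRun.integral_obj_le {Ω : Type*} [MeasurableSpace Ω] {P : Measure Ω}
    [IsProbabilityMeasure P] {n d m : ℕ} {f : Fin n → Vec d → ℝ} {T : Fin n → Finset (Fin d)}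
    {L μ ρ ω : ℝ} {xstar x0 : Vec d} {A : Execution Ω n d m} {R τ : ℕ}
    (h : IsProblem f T L μ xstar) (hω : 0 < ω) (hm : 0 < m)
    (hA : IsRun P A f T (theta (L / μ) ρ m) (phi L (theta (L / μ) ρ m))
      (eta L (theta (L / μ) ρ m) ρ) (epochs ω (L / μ) ρ m) R τ x0)
    (hρ : 1 + 2 * √(sparsity T) * τ ≤ ρ) :
    ∫ w, obj f (A.x R w) ∂P - obj f xstar ≤ (1 / ω) ^ R * (obj f x0 - obj f xstar) := by
  -- In dimension zero `Δ = 0`, which the descent estimate excludes, but there is only one point.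
  rcases Nat.eq_zero_or_pos d with rfl | hd
  · have : ∀ x, obj f x = obj f xstar := fun x => by rw [Subsingleton.elim x xstar]
    simp [this]
  have hΔ := h.sparsity_pos ⟨0, hd⟩
  have hρ0 : 0 < ρ := lt_of_lt_of_le (by positivity) hρ
  have hκ : 0 < L / μ := div_pos h.L_pos h.mu_pos
  suffices H : ∀ r ≤ R,
      ∫ w, obj f (A.x r w) ∂P - obj f xstar ≤ (1 / ω) ^ r * (obj f x0 - obj f xstar) from
    H R le_rfl
  intro r hr
  induction r with
  | zero => simp [hA.init]
  | succ r ih =>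
    have hrR : r < R := hr
    have i1 := ((hA.boundedMeasurable_x h hrR.le).comp h.differentiable_obj.continuous).integrable
      (P := P)
    have hnonneg : 0 ≤ ∫ w, obj f (A.x r w) ∂P - obj f xstar := by
      have := integral_mono (integrable_const (obj f xstar)) i1 fun w =>
        sub_nonneg.1 (le_trans (mul_nonneg (half_pos h.mu_pos).le (sq_nonneg _))
          (h.growth (A.x r w)))
      simpa using this
    have h1 := hA.round h hrR (epochs_pos hω hκ hρ0 hm) (theta_pos hκ hρ0 hm)
      (theta_lt_one hκ hρ0 hm) hΔ hm hρ
    refine h1.trans ((mul_le_mul_of_nonneg_right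
      (contraction_factor_le hω h.L_pos h.mu_pos hρ0 hm) hnonneg).trans ?_)
    rw [pow_succ', mul_assoc]
    exact mul_le_mul_of_nonneg_left (ih hrR.le) (by positivity)

end AsyncSVRG

/-! ### Constants and oracle complexity -/

theorem corollary1 :
    -- the constants of `ω`, of `m = Θ(n)` and of the bound on the overlaps; `C` depends on them only
    ∀ ω c₁ c₂ c : ℝ, 1 < ω → 0 < c₁ → 0 < c₂ → 0 < c →
    ∃ C : ℝ, 0 < C ∧
    ∀ (n d : ℕ) (f : Fin n → AsyncSVRG.Vec d → ℝ) (T : Fin n → Finset (Fin d)) (L μ : ℝ)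
      (xstar : AsyncSVRG.Vec d), AsyncSVRG.IsProblem f T L μ xstar →
    ∀ (m : ℕ), c₁ * (n : ℝ) ≤ (m : ℝ) → (m : ℝ) ≤ c₂ * (n : ℝ) →
    ∀ (κ Δ B : ℝ), κ = L / μ → Δ = AsyncSVRG.sparsity T → B = 1 / √Δ * max ((n : ℝ) / κ) 1 →
    ∀ (τ : ℕ), (τ : ℝ) ≤ c * B →
    ∀ (τt : ℝ), (τ : ℝ) ≤ τt → τt ≤ c * B →
    ∀ (ρ ϑ φ η : ℝ) (S : ℕ), ρ = 1 + 2 * √Δ * τt →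
      ϑ = AsyncSVRG.theta κ ρ m → φ = AsyncSVRG.phi L ϑ → η = AsyncSVRG.eta L ϑ ρ →
      S = AsyncSVRG.epochs ω κ ρ m →
    (S : ℝ) ≤ C * max 1 √(κ / (n : ℝ)) ∧
    ∀ (x0 : AsyncSVRG.Vec d) (ε logTerm : ℝ), 0 < ε →
      logTerm = max 1 (Real.log ((AsyncSVRG.obj f x0 - AsyncSVRG.obj f xstar) / ε)) →
    ∃ R : ℕ, (R : ℝ) ≤ C * logTerm ∧
      AsyncSVRG.oracleCalls n m S R = R * S * (n + 2 * m) ∧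
      (AsyncSVRG.oracleCalls n m S R : ℝ) ≤ C * (max (n : ℝ) √(κ * (n : ℝ)) * logTerm) ∧
      ∀ (Ω : Type*) [MeasurableSpace Ω] (P : MeasureTheory.Measure Ω)
        [MeasureTheory.IsProbabilityMeasure P] (A : AsyncSVRG.Execution Ω n d m),
        AsyncSVRG.IsRun P A f T ϑ φ η S R τ x0 →
        MeasureTheory.Integrable (fun w => AsyncSVRG.obj f (A.x R w)) P ∧
        ∫ w, AsyncSVRG.obj f (A.x R w) ∂P - AsyncSVRG.obj f xstar ≤ ε := by
  intro ω c₁ c₂ c hω hc₁ hc₂ hc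
  have hω0 : 0 < ω := one_pos.trans hω
  have hlog : 0 < Real.log ω := Real.log_pos hω
  -- `CS` controls the epochs per round, `CR` the rounds and `CG` the cost of an epoch in units of
  -- `n`. All are at least `1`, so their product serves every bound.
  set CS := 2 * ω * √((1 + 2 * c) / c₁) + 1 with hCS
  set CR := 1 / Real.log ω + 1 with hCR
  set CG := 1 + 2 * c₂ with hCG
  have hCS1 : 1 ≤ CS := le_add_of_nonneg_left (by positivity)
  have hCR1 : 1 ≤ CR := le_add_of_nonneg_left (by positivity)
  have hCG1 : 1 ≤ CG := le_add_of_nonneg_right (by positivity)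
  refine ⟨CR * CS * CG, by positivity, ?_⟩
  intro n d f T L μ xstar h m hm₁ hm₂ κ Δ B hκ hΔ hB τ _ τt hτt hτtB ρ ϑ φ η S hρ hϑ hφ hη hS
  have hn := h.natCast_pos
  have hm : 0 < m := Nat.cast_pos.1 (lt_of_lt_of_le (by positivity) hm₁)
  have hκ0 : 0 < κ := hκ ▸ div_pos h.L_pos h.mu_pos
  have hρle : ρ ≤ 1 + 2 * (c * max ((n : ℝ) / κ) 1) := by
    have := AsyncSVRG.sqrt_mul_le_of_le hc.le (zero_le_one.trans (le_max_right ((n : ℝ) / κ) 1))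
      (hB ▸ hτtB)
    rw [hρ]
    linarith
  have hρge : 1 + 2 * √(AsyncSVRG.sparsity T) * τ ≤ ρ := by
    rw [hρ, hΔ]
    gcongr
  have hSle : (S : ℝ) ≤ CS * max 1 √(κ / (n : ℝ)) :=
    hS ▸ AsyncSVRG.epochs_le hω0.le hc₁ hc.le hn hκ0 hm₁ hρle
  have hmax : 0 < max 1 √(κ / (n : ℝ)) := lt_max_of_lt_left one_pos
  refine ⟨hSle.trans (mul_le_mul_of_nonneg_right ?_ hmax.le), ?_⟩
  · calc CS = 1 * CS * 1 := by ring
      _ ≤ CR * CS * CG := by gcongr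
  intro x0 ε ℓ hε hℓ
  have hℓ1 : 1 ≤ ℓ := hℓ ▸ le_max_left _ _
  -- The rounding error is at most `1 ≤ ℓ`.
  have hRle : (⌈ℓ / Real.log ω⌉₊ : ℝ) ≤ CR * ℓ := by
    have := (Nat.ceil_lt_add_one (show 0 ≤ ℓ / Real.log ω by positivity)).le
    calc _ ≤ ℓ / Real.log ω + ℓ := by linarith
      _ = CR * ℓ := by rw [hCR]; ring
  refine ⟨⌈ℓ / Real.log ω⌉₊, hRle.trans (mul_le_mul_of_nonneg_right ?_ (by positivity)),
    AsyncSVRG.oracleCalls_eq _ _ _ _, ?_, ?_⟩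
  · calc CR = CR * 1 * 1 := by ring
      _ ≤ CR * CS * CG := by gcongr
  · rw [AsyncSVRG.oracleCalls_eq, ← AsyncSVRG.mul_max_one_sqrt_div hn]
    push_cast
    calc (⌈ℓ / Real.log ω⌉₊ : ℝ) * S * (n + 2 * m)
        ≤ CR * ℓ * (CS * max 1 √(κ / (n : ℝ))) * (n + 2 * (c₂ * n)) := by gcongr
      _ = _ := by rw [hCG]; ring
  · intro Ω _ P _ A hA
    refine ⟨((hA.boundedMeasurable_x h le_rfl).comp h.differentiable_obj.continuous).integrable, ?_⟩
    subst hκ hφ hη hS hϑ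
    refine (AsyncSVRG.IsRun.integral_obj_le h hω0 hm hA hρge).trans
      (AsyncSVRG.mul_inv_pow_le hω ?_ hε ?_)
    · exact le_trans (mul_nonneg (half_pos h.mu_pos).le (sq_nonneg _)) (h.growth x0)
    · refine le_trans ?_ (Nat.le_ceil _)
      rw [hℓ]
      gcongr
      exact le_max_right _ _
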